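/- Let $\Gamma$ be a set (the lattice) and let $\mathcal A$ be a unital $C^*$-algebra which is one of the following. (Spin) A quantum spin lattice system on $\Gamma$: to every finite $I\subset\Gamma$ there is a $*$-subalgebra $\mathcal A(I)\ni 1$ isomorphic to a full matrix algebra, with $\mathcal A(I\cup J)=\mathcal A(I)\otimes\mathcal A(J)$ for disjoint $I,J$ (the two subalgebras commute and the multiplication map $\mathcal A(I)\otimes\mathcal A(J)\to\mathcal A(I\cup J)$ is bijective), and $\bigcup_I\mathcal A(I)$ is dense in $\mathcal A$. (Fermion) A fermion lattice system on $\Gamma$: there are $c_i\in\mathcal A$ $(i\in\Gamma)$ with $c_i^*c_j+c_jc_i^*=\delta_{ij}1$ and $c_ic_j+c_jc_i=0$; $\mathcal A(I)$ is the unital $*$-algebra generated by $\{c_i: i\in I\}$ for finite $I$, and $\bigcup_I\mathcal A(I)$ is dense in $\mathcal A$. Let $\Theta$ be the $*$-automorphism of $\mathcal A$ with $\Theta(c_i)=-c_i$; an element or a state is even if it is invariant under $\Theta$. For an infinite $J\subset\Gamma$, $\mathcal A(J)$ is the $C^*$-subalgebra generated by the $\mathcal A(I)$ with $I\subset J$ finite.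 A potential is a map $\Phi$ with $\Phi(K)=\Phi(K)^*\in\mathcal A(K)$ for each finite $K\subset\Gamma$ (each $\Phi(K)$ even in the fermion case) such that for every finite $I$ the surface energy $H_{\partial I}=\sum_{K\cap I\ne\emptyset,\,K\cap I^c\neq\emptyset}\Phi(K)$ exists in $\mathcal A$, as the norm limit of the partial sums over $K\subset\Lambda$ as the finite set $\Lambda$ increases to $\Gamma$. For a state $\psi$ of $\mathcal A$ let $S_I(\psi)=-\mathrm{Tr}(D\log D)$, where $D$ is the density matrix of $\psi|_{\mathcal A(I)}$, and define the mutual entropy of $\psi$ between a finite $A\subset\Gamma$ and its complement by $$I_\psi(A:A^c)=S_A(\psi)-\inf_{\Lambda\subset A^c\text{ finite}}\bigl(S_{A\cup\Lambda}(\psi)-S_\Lambda(\psi)\bigr).$$ Let $\beta>0$, let $A\subset\Gamma$ be finite, let $\Phi$ be a potential, and let $\varphi$ be a state of $\mathcal A$, even in the fermion case, which satisfies the thermal area law $$I_\varphi(A:A^c)\le 2\beta\|H_{\partial A}\| .$$ Then there is exactly one state $\omega$ of $\mathcal A$ with $\omega(ab)=\varphi(a)\varphi(b)$ for all $a\in\mathcal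 A(A)$, $b\in\mathcal A(A^c)$, namely the product state, written $\varphi_A\otimes\varphi_{A^c}$ in the spin case and $\varphi_A\otimes_{\mathrm{car}}\varphi_{A^c}$ in the fermion case, and $$\|\omega-\varphi\|^2\le 4\beta\|H_{\partial A}\| .$$ Moreover $$|\varphi(\mathcal O_A\mathcal O_B)-\varphi(\mathcal O_A)\varphi(\mathcal O_B)|\le 2\,(\beta\|H_{\partial A}\|)^{1/2}$$ for all $\mathcal O_A\in\mathcal A(A)$ and $\mathcal O_B\in\mathcal A(A^c)$ with $\|\mathcal O_A\|\le1$ and $\|\mathcal O_B\|\le1$. -/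

import Mathlib

open scoped ComplexOrder Topology

namespace QuantumLattice

/-! ### States, local nets and entropies -/

section General

/-- A state of a unital C⋆-algebra: a positive normalized linear functional. (Positive functionals
are automatically bounded, so starting from bounded ones is no restriction.) -/
structure IsState {𝒜 : Type*} [CStarAlgebra 𝒜] (φ : StrongDual ℂ 𝒜) : Prop where
  map_one : φ 1 = 1
  nonneg : ∀ a : 𝒜, 0 ≤ φ (star a * a)

/-- The algebra of an arbitrary (finite or infinite) region `J`: the C⋆-subalgebra generated by the
local algebras of the finite subsets of `J`. -/
noncomputable def regionAlgebra {Γ 𝒜 : Type*} [CStarAlgebra 𝒜]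
    (alg : Finset Γ → StarSubalgebra ℂ 𝒜) (J : Set Γ) : StarSubalgebra ℂ 𝒜 :=
  (⨆ I : {I : Finset Γ // (I : Set Γ) ⊆ J}, alg I.1).topologicalClosure

/-- The density matrix of the restriction of `ψ` to a subalgebra `B` identified with a full matrix
algebra by `e`, with respect to the matrix trace: the matrix `D` for which
`ψ b = Tr (D * e b)` for all `b` in `B`. -/
noncomputable def densityMatrix {𝒜 : Type*} [CStarAlgebra 𝒜] {B : StarSubalgebra ℂ 𝒜} {n : ℕ}
    (e : B ≃⋆ₐ[ℂ] Matrix (Fin n) (Fin n) ℂ) (ψ : StrongDual ℂ 𝒜) : Matrix (Fin n) (Fin n) ℂ :=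
  Matrix.of fun i j => ψ (e.symm (Matrix.single j i 1) : 𝒜)

theorem trace_densityMatrix_mul {𝒜 : Type*} [CStarAlgebra 𝒜] {B : StarSubalgebra ℂ 𝒜} {n : ℕ}
    (e : B ≃⋆ₐ[ℂ] Matrix (Fin n) (Fin n) ℂ) (ψ : StrongDual ℂ 𝒜) (b : B) :
    (densityMatrix e ψ * e b).trace = ψ (b : 𝒜) := by
  let f : Matrix (Fin n) (Fin n) ℂ →ₗ[ℂ] ℂ :=
    { toFun := fun M => ψ (e.symm M : 𝒜)
      map_add' := by intros; simp
      map_smul' := by intros; simp }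
  have h1 : f (e b) = ψ (b : 𝒜) := by simp [f]
  have h2 : ∀ i j, densityMatrix e ψ i j = f (Matrix.single j i 1) := fun i j => rfl
  rw [← h1]
  conv_rhs => rw [Matrix.matrix_eq_sum_single (e b)]
  simp only [Matrix.trace, Matrix.diag, Matrix.mul_apply, map_sum, h2]
  rw [Finset.sum_comm]
  refine Finset.sum_congr rfl fun i _ => Finset.sum_congr rfl fun j _ => ?_
  have : Matrix.single i j (e b i j) = (e b i j) • Matrix.single i j (1 : ℂ) := by simp
  rw [this, map_smul, smul_eq_mul, mul_comm]

open Classical in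
/-- The von Neumann entropy `-Tr (D log D)` of the restriction of `ψ` to a subalgebra `B` which is
isomorphic to a full matrix algebra (it does not depend on the isomorphism, since automorphisms of
full matrix algebras are inner). The local algebras of the lattice systems below are all of this
form. -/
noncomputable def vonNeumannEntropy {𝒜 : Type*} [CStarAlgebra 𝒜] (B : StarSubalgebra ℂ 𝒜)
    (ψ : StrongDual ℂ 𝒜) : ℝ :=
  if h : ∃ n : ℕ, Nonempty (B ≃⋆ₐ[ℂ] Matrix (Fin n) (Fin n) ℂ) then
    -(densityMatrix h.choose_spec.some ψ *
      cfc Real.log (densityMatrix h.choose_spec.some ψ)).trace.re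
  else 0

open Classical in
/-- The conditional entropy of `ψ` on the finite region `I` given the region `J`: the infimum of
`S_{I ∪ Λ}(ψ) - S_Λ(ψ)` over the finite subsets `Λ` of `J`. -/
noncomputable def conditionalEntropy {Γ 𝒜 : Type*} [CStarAlgebra 𝒜]
    (alg : Finset Γ → StarSubalgebra ℂ 𝒜) (ψ : StrongDual ℂ 𝒜) (I : Finset Γ) (J : Set Γ) :
    EReal :=
  ⨅ Λ : {Λ : Finset Γ // (Λ : Set Γ) ⊆ J},
    ((vonNeumannEntropy (alg (I ∪ Λ.1)) ψ - vonNeumannEntropy (alg Λ.1) ψ : ℝ) : EReal)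

/-- The mutual entropy `S_I(ψ) - S_{I|J}(ψ)` of `ψ` between the finite region `I` and the disjoint
region `J`. -/
noncomputable def mutualEntropy {Γ 𝒜 : Type*} [CStarAlgebra 𝒜]
    (alg : Finset Γ → StarSubalgebra ℂ 𝒜) (ψ : StrongDual ℂ 𝒜) (I : Finset Γ) (J : Set Γ) :
    EReal :=
  (vonNeumannEntropy (alg I) ψ : EReal) - conditionalEntropy alg ψ I J

/-- `ω` is the product of the restrictions of `φ` to the region `A` and to its complement: a state
with `ω (a b) = φ a * φ b` for `a` in the algebra of `A` and `b` in the algebra of the complement.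
This is `φ_A ⊗ φ_{Aᶜ}` for spin systems and the product-state extension for fermion systems. -/
structure IsProductState {Γ 𝒜 : Type*} [CStarAlgebra 𝒜] (alg : Finset Γ → StarSubalgebra ℂ 𝒜)
    (φ : StrongDual ℂ 𝒜) (A : Finset Γ) (ω : StrongDual ℂ 𝒜) : Prop where
  isState : IsState ω
  map_mul : ∀ a ∈ alg A, ∀ b ∈ regionAlgebra alg (A : Set Γ)ᶜ, ω (a * b) = φ a * φ b

open Classical in
/-- The sum of the interaction terms `Φ K`, with `K` inside the finite window `Λ`, such that `K`
meets both `I` and its complement. -/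
noncomputable def surfaceSum {Γ 𝒜 : Type*} [CStarAlgebra 𝒜] (Φ : Finset Γ → 𝒜)
    (I Λ : Finset Γ) : 𝒜 :=
  ∑ K ∈ Λ.powerset.filter fun K : Finset Γ =>
    ((K : Set Γ) ∩ (I : Set Γ)).Nonempty ∧ ((K : Set Γ) ∩ (I : Set Γ)ᶜ).Nonempty, Φ K

/-- A potential: a self-adjoint `Φ K` in the local algebra of each finite `K`, such that for every
finite `I` the sum defining the surface energy of `I` converges in norm as the finite window grows
to the whole lattice. -/
structure Potential {Γ 𝒜 : Type*} [CStarAlgebra 𝒜] (alg : Finset Γ → StarSubalgebra ℂ 𝒜) where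
  toFun : Finset Γ → 𝒜
  isSelfAdjoint : ∀ K, IsSelfAdjoint (toFun K)
  mem : ∀ K, toFun K ∈ alg K
  surface_exists : ∀ I : Finset Γ, ∃ H : 𝒜,
    Filter.Tendsto (fun Λ : Finset Γ => surfaceSum toFun I Λ) Filter.atTop (𝓝 H)

/-- The surface energy `H_{∂I}`: the (unique) limit of the sums of all `Φ K` such that `K` meets
both `I` and its complement. -/
noncomputable def Potential.surfaceEnergy {Γ 𝒜 : Type*} [CStarAlgebra 𝒜]
    {alg : Finset Γ → StarSubalgebra ℂ 𝒜} (Φ : Potential alg) (I : Finset Γ) : 𝒜 :=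
  (Φ.surface_exists I).choose

end General

/-! ### Quantum spin lattice systems -/

section Spin

open Classical in
/-- A quantum spin lattice system on `Γ`: the local algebras are full matrix algebras, their union
is dense, and for disjoint `I`, `J` the algebra of `I ∪ J` is the tensor product of those of `I` and
`J` (they commute, and the multiplication map from their tensor product is injective with range
the algebra of `I ∪ J`). -/
structure SpinSystem (Γ 𝒜 : Type*) [CStarAlgebra 𝒜] where
  alg : Finset Γ → StarSubalgebra ℂ 𝒜
  matrix : ∀ I, ∃ k : ℕ, Nonempty (alg I ≃⋆ₐ[ℂ] Matrix (Fin k) (Fin k) ℂ)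
  commute : ∀ I J : Finset Γ, Disjoint I J → ∀ a ∈ alg I, ∀ b ∈ alg J, Commute a b
  mulMap_injective : ∀ I J : Finset Γ, Disjoint I J →
    Function.Injective (Submodule.mulMap (Subalgebra.toSubmodule (alg I).toSubalgebra)
      (Subalgebra.toSubmodule (alg J).toSubalgebra))
  mulMap_range : ∀ I J : Finset Γ, Disjoint I J →
    LinearMap.range (Submodule.mulMap (Subalgebra.toSubmodule (alg I).toSubalgebra)
      (Subalgebra.toSubmodule (alg J).toSubalgebra)) =
      Subalgebra.toSubmodule (alg (I ∪ J)).toSubalgebra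
  dense : Dense (⋃ I, (alg I : Set 𝒜))

end Spin

/-! ### Fermion lattice systems -/

section Fermion

open Classical in
/-- A fermion lattice system on `Γ`: annihilation operators `c i` satisfying the canonical
anticommutation relations, such that the local algebras generated by finitely many of them have a
dense union. -/
structure FermionSystem (Γ 𝒜 : Type*) [CStarAlgebra 𝒜] where
  c : Γ → 𝒜
  star_anticomm : ∀ i j, star (c i) * c j + c j * star (c i) = if i = j then 1 else 0
  anticomm : ∀ i j, c i * c j + c j * c i = 0
  dense : Dense (⋃ I : Finset Γ, (StarAlgebra.adjoin ℂ (c '' (I : Set Γ)) : Set 𝒜))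

namespace FermionSystem

variable {Γ 𝒜 : Type*} [CStarAlgebra 𝒜] (F : FermionSystem Γ 𝒜)

/-- The local algebra of a finite region. -/
noncomputable def alg (I : Finset Γ) : StarSubalgebra ℂ 𝒜 :=
  StarAlgebra.adjoin ℂ (F.c '' (I : Set Γ))

theorem alg_mono {I J : Finset Γ} (h : I ⊆ J) : F.alg I ≤ F.alg J :=
  StarAlgebra.adjoin_le ((Set.image_mono (Finset.coe_subset.2 h)).trans
    (StarAlgebra.subset_adjoin ℂ _))

theorem exists_local_parity (I : Finset Γ) : ∃ v : unitary 𝒜,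
    (∀ i ∈ I, (v : 𝒜) * F.c i * star (v : 𝒜) = -F.c i) ∧
      ∀ j ∉ I, (v : 𝒜) * F.c j * star (v : 𝒜) = F.c j := by
  classical
  induction I using Finset.induction_on with
  | empty => exact ⟨1, by simp, by simp⟩
  | insert i I hi ih =>
    obtain ⟨v, h1, h2⟩ := ih
    have cc : F.c i * F.c i = 0 := by
      have h := F.anticomm i i
      rw [← two_smul ℂ] at h
      simpa using h
    have sc : F.c i * star (F.c i) = 1 - star (F.c i) * F.c i := by
      have h := F.star_anticomm i i
      rw [if_pos rfl] at h
      exact eq_sub_of_add_eq' h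
    set n : 𝒜 := star (F.c i) * F.c i with hn
    have nc : n * F.c i = 0 := by rw [hn, mul_assoc, cc, mul_zero]
    have cn : F.c i * n = F.c i := by
      rw [hn, ← mul_assoc, sc, sub_mul, nc, one_mul, sub_zero]
    have nn : n * n = n := by
      nth_rewrite 1 [hn]
      rw [mul_assoc, cn]
    have sn : star n = n := by simp [hn]
    have nj : ∀ j, j ≠ i → n * F.c j = F.c j * n := by
      intro j hj
      have e1 : F.c i * F.c j = -(F.c j * F.c i) := eq_neg_of_add_eq_zero_left (F.anticomm i j)
      have e2 : star (F.c i) * F.c j = -(F.c j * star (F.c i)) := by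
        have h := F.star_anticomm i j
        rw [if_neg (Ne.symm hj)] at h
        exact eq_neg_of_add_eq_zero_left h
      rw [hn, mul_assoc, e1, mul_neg, ← mul_assoc, e2, neg_mul, neg_neg, mul_assoc]
    set u : 𝒜 := 1 - (n + n) with hu
    have su : star u = u := by simp [hu, sn]
    have uu : u * u = 1 := by
      simp only [hu, mul_sub, sub_mul, mul_add, add_mul, nn, mul_one, one_mul]
      abel
    have uc : u * F.c i * u = -F.c i := by
      have e1 : u * F.c i = F.c i := by simp [hu, sub_mul, add_mul, nc]
      rw [e1]
      simp [hu, mul_sub, mul_add, cn]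
    have uj : ∀ j, j ≠ i → u * F.c j * u = F.c j := by
      intro j hj
      have e1 : u * F.c j = F.c j * u := by
        simp [hu, sub_mul, add_mul, mul_sub, mul_add, nj j hj]
      rw [e1, mul_assoc, uu, mul_one]
    let w : unitary 𝒜 := ⟨u, by rw [Unitary.mem_iff, su]; exact ⟨uu, uu⟩⟩
    have key : ∀ x : 𝒜, ((v * w : unitary 𝒜) : 𝒜) * x * star ((v * w : unitary 𝒜) : 𝒜) =
        (v : 𝒜) * (u * x * u) * star (v : 𝒜) := by
      intro x
      have hw : (w : 𝒜) = u := rfl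
      simp only [Submonoid.coe_mul, hw, star_mul, su, mul_assoc]
    refine ⟨v * w, ?_, ?_⟩
    · intro j hj
      rw [key]
      rcases eq_or_ne j i with rfl | hne
      · rw [uc, mul_neg, neg_mul, h2 j hi]
      · rw [uj j hne, h1 j ((Finset.mem_insert.1 hj).resolve_left hne)]
    · intro j hj
      rw [Finset.mem_insert, not_or] at hj
      rw [key, uj j hj.1, h2 j hj.2]

open scoped CStarAlgebra in
theorem ext_hom {f g : 𝒜 →⋆ₐ[ℂ] 𝒜} (h : ∀ i, f (F.c i) = g (F.c i)) : f = g := by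
  have hloc : ∀ I : Finset Γ, F.alg I ≤ StarAlgHom.equalizer f g := fun I =>
    StarAlgHom.adjoin_le_equalizer f g (by rintro _ ⟨i, _, rfl⟩; exact h i)
  have : (f : 𝒜 → 𝒜) = g := by
    refine Continuous.ext_on F.dense (map_continuous f) (map_continuous g) ?_
    intro a ha
    obtain ⟨I, hI⟩ := Set.mem_iUnion.1 ha
    exact hloc I hI
  exact DFunLike.coe_injective this

/-- There is exactly one grading automorphism: the one with `c i ↦ -c i`. -/
theorem existsUnique_grading : ∃! Θ : 𝒜 ≃⋆ₐ[ℂ] 𝒜, ∀ i, Θ (F.c i) = -F.c i := by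
  classical
  choose v hv1 hv2 using F.exists_local_parity
  let θ : Finset Γ → 𝒜 ≃⋆ₐ[ℂ] 𝒜 := fun I => Unitary.conjStarAlgAut ℂ 𝒜 (v I)
  have hθ : ∀ I a, θ I a = (v I : 𝒜) * a * star (v I : 𝒜) := fun I a =>
    Unitary.conjStarAlgAut_apply _ _
  have hθc : ∀ I, ∀ i ∈ I, θ I (F.c i) = -F.c i := fun I i hi => by rw [hθ, hv1 I i hi]
  have hnorm : ∀ I a, ‖θ I a‖ = ‖a‖ := fun I a => by
    rw [hθ, ← Unitary.coe_star, CStarRing.norm_mul_coe_unitary, CStarRing.norm_coe_unitary_mul]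
  have hagree : ∀ I J, I ⊆ J → ∀ a ∈ F.alg I, θ J a = θ I a := by
    intro I J hIJ a ha
    have : F.alg I ≤ StarAlgHom.equalizer (θ J : 𝒜 →⋆ₐ[ℂ] 𝒜) (θ I : 𝒜 →⋆ₐ[ℂ] 𝒜) := by
      refine StarAlgHom.adjoin_le_equalizer _ _ ?_
      rintro _ ⟨i, hi, rfl⟩
      exact (hθc J i (hIJ hi)).trans (hθc I i hi).symm
    exact this ha
  have hlim : ∀ a, ∃ l, Filter.Tendsto (fun I => θ I a) Filter.atTop (𝓝 l) := by
    intro a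
    refine cauchySeq_tendsto_of_complete (Metric.cauchySeq_iff'.2 fun ε hε => ?_)
    obtain ⟨b, hb, hab⟩ := F.dense.exists_dist_lt a (half_pos hε)
    obtain ⟨I, hI⟩ := Set.mem_iUnion.1 hb
    refine ⟨I, fun J hJ => ?_⟩
    have e : θ J a - θ I a = θ J (a - b) - θ I (a - b) := by
      rw [map_sub, map_sub, hagree I J hJ b hI]; abel
    rw [dist_eq_norm, e]
    rw [dist_eq_norm] at hab
    calc ‖θ J (a - b) - θ I (a - b)‖ ≤ ‖θ J (a - b)‖ + ‖θ I (a - b)‖ := norm_sub_le _ _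
      _ < ε := by rw [hnorm, hnorm]; linarith
  choose L hL using hlim
  let T : 𝒜 →⋆ₐ[ℂ] 𝒜 :=
    { toFun := L
      map_one' := tendsto_nhds_unique (hL 1) (by simp)
      map_mul' := fun a b => tendsto_nhds_unique (hL (a * b)) (by
        simpa only [map_mul] using (hL a).mul (hL b))
      map_zero' := tendsto_nhds_unique (hL 0) (by simp)
      map_add' := fun a b => tendsto_nhds_unique (hL (a + b)) (by
        simpa only [map_add] using (hL a).add (hL b))
      commutes' := fun r => tendsto_nhds_unique (hL _) (by
        have : ∀ I, θ I (algebraMap ℂ 𝒜 r) = algebraMap ℂ 𝒜 r := fun I => by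
          rw [Algebra.algebraMap_eq_smul_one, map_smul, map_one]
        simp only [this]
        exact tendsto_const_nhds)
      map_star' := fun a => tendsto_nhds_unique (hL (star a)) (by
        simpa only [map_star] using (hL a).star) }
  have hTc : ∀ i, T (F.c i) = -F.c i := fun i => by
    refine tendsto_nhds_unique (hL (F.c i)) (tendsto_const_nhds.congr' ?_)
    filter_upwards [Filter.eventually_ge_atTop ({i} : Finset Γ)] with I hI
    exact (hθc I i (hI (Finset.mem_singleton_self i))).symm
  have hTT : T.comp T = StarAlgHom.id ℂ 𝒜 := F.ext_hom fun i => by simp [hTc]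
  refine ⟨StarAlgEquiv.ofStarAlgHom T T hTT hTT, hTc, ?_⟩
  intro Θ hΘ
  have : (Θ : 𝒜 →⋆ₐ[ℂ] 𝒜) = T := F.ext_hom fun i => (hΘ i).trans (hTc i).symm
  ext a
  exact DFunLike.congr_fun this a

/-- The fermion grading `Θ`: the automorphism with `Θ (c i) = -c i`. -/
noncomputable def grading : 𝒜 ≃⋆ₐ[ℂ] 𝒜 :=
  F.existsUnique_grading.choose

theorem grading_c (i : Γ) : F.grading (F.c i) = -F.c i :=
  F.existsUnique_grading.choose_spec.1 i

/-- A state is even if it is invariant under the grading. -/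
def IsEven (φ : StrongDual ℂ 𝒜) : Prop :=
  ∀ a, φ (F.grading a) = φ a

end FermionSystem

end Fermion

end QuantumLattice

/-!
If `ω` is the product of the marginals of `φ` on two commuting matrix algebras, the mutual entropy
is the relative entropy of `φ` with respect to `ω`, and the norm estimate is Pinsker's inequality.
To reduce Pinsker's inequality to real numbers, let `l i`, `e i` and `q j`, `f j` be the eigenvalues
and eigenvectors of the two densities, and `u i j` the inner product of `f j` with `e i`. The masses
`|u i j| ^ 2 * l i` and `|u i j| ^ 2 * q j` have the quantum relative entropy as their classical
one, and `φ x - ω x` is the sum of `(l i - q j) * conj (u i j) * ⟪f j, x (e i)⟫`, so that the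
Cauchy-Schwarz inequality gives `|φ x - ω x| ^ 2 ≤ 2 * S * ‖x‖ ^ 2` for every `x`, self-adjoint or
not.

To construct the product state on the whole algebra, let `l k` be the eigenvalues of the density of
`φ` on `𝒜(A)` and `e k m` matrix units in its eigenbasis, and let `ω x` be the sum over `k` and `m`
of `l k * φ (e m k * x * e k m)`; each summand is positive because `star (e k m) = e m k`.

For fermions the odd elements of disjoint regions anticommute. The Klein transformation multiplies
the odd elements outside `A` by the parity operator of `A`; the result commutes with `𝒜(A)`,
generates the same algebra together with it, and is not noticed by an even state. All estimates are
uniform in the finite region outside `A` and pass to the limit by density.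
-/

namespace QuantumLattice

section Pinsker

open Finset InformationTheory Real

theorem two_mul_sub_one_le_add_one_mul_log {x : ℝ} (hx : 1 ≤ x) :
    2 * (x - 1) ≤ (x + 1) * log x := by
  have h := le_log_one_add_of_nonneg (sub_nonneg.2 hx)
  rw [div_le_iff₀ (by linarith), add_sub_cancel] at h
  linarith

theorem add_one_mul_log_le_two_mul_sub_one {x : ℝ} (hx : 0 < x) (hx1 : x ≤ 1) :
    (x + 1) * log x ≤ 2 * (x - 1) := by
  have h := two_mul_sub_one_le_add_one_mul_log ((one_le_inv₀ hx).2 hx1)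
  rw [log_inv] at h
  have h' := mul_le_mul_of_nonneg_left h hx.le
  field_simp at h'
  linarith

theorem three_mul_sub_one_sq_le_mul_klFun {x : ℝ} (hx : 0 ≤ x) :
    3 * (x - 1) ^ 2 ≤ (2 * x + 4) * klFun x := by
  let f : ℝ → ℝ := fun y => (2 * y + 4) * klFun y - 3 * (y - 1) ^ 2
  have hf : ContinuousOn f Set.univ := by
    have := continuous_klFun
    fun_prop
  have hderiv : ∀ y : ℝ, 0 < y → HasDerivAt f (4 * ((y + 1) * log y - 2 * (y - 1))) y := by
    intro y hy
    have h1 : HasDerivAt (fun y : ℝ => 2 * y + 4) 2 y := by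
      simpa using ((hasDerivAt_id y).const_mul 2).add_const 4
    have h2 : HasDerivAt (fun y : ℝ => 3 * (y - 1) ^ 2) (3 * (2 * (y - 1))) y := by
      simpa using (((hasDerivAt_id y).sub_const 1).pow 2).const_mul 3
    refine ((h1.mul (hasDerivAt_klFun hy.ne')).sub h2).congr_deriv ?_
    rw [klFun_apply]
    ring
  have hf1 : f 1 = 0 := by simp [f, klFun_one]
  rw [← sub_nonneg, ← hf1]
  rcases le_total x 1 with hx1 | hx1
  · refine antitoneOn_of_hasDerivWithinAt_nonpos (convex_Icc 0 1) (hf.mono (Set.subset_univ _))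
      (f' := fun y => 4 * ((y + 1) * log y - 2 * (y - 1))) ?_ ?_ ⟨hx, hx1⟩
      (Set.right_mem_Icc.2 zero_le_one) hx1 <;> rw [interior_Icc] <;> intro y hy
    · exact (hderiv y hy.1).hasDerivWithinAt
    · linarith [add_one_mul_log_le_two_mul_sub_one hy.1 hy.2.le]
  · refine monotoneOn_of_hasDerivWithinAt_nonneg (convex_Ici 1) (hf.mono (Set.subset_univ _))
      (f' := fun y => 4 * ((y + 1) * log y - 2 * (y - 1))) ?_ ?_ Set.self_mem_Ici hx1 hx1 <;>
      rw [interior_Ici] <;> intro y hy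
    · exact (hderiv y (zero_lt_one.trans hy)).hasDerivWithinAt
    · linarith [two_mul_sub_one_le_add_one_mul_log (le_of_lt hy)]

theorem mul_klFun_div {l q : ℝ} (h : q = 0 → l = 0) :
    q * klFun (l / q) = l * (log l - log q) - l + q := by
  rcases eq_or_ne q 0 with rfl | hq
  · simp [h rfl]
  rcases eq_or_ne l 0 with rfl | hl
  · simp [klFun_zero]
  rw [klFun_apply, log_div hl hq]
  field_simp
  ring

theorem three_mul_sub_sq_le_mul_klFun_div {l q : ℝ} (hl : 0 ≤ l) (hq : 0 ≤ q)
    (h : q = 0 → l = 0) : 3 * (l - q) ^ 2 ≤ (2 * l + 4 * q) * (q * klFun (l / q)) := by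
  rcases hq.eq_or_lt with rfl | hq
  · simp [h rfl]
  calc 3 * (l - q) ^ 2 = q ^ 2 * (3 * (l / q - 1) ^ 2) := by field_simp
    _ ≤ q ^ 2 * ((2 * (l / q) + 4) * klFun (l / q)) :=
        mul_le_mul_of_nonneg_left (three_mul_sub_one_sq_le_mul_klFun (div_nonneg hl hq.le))
          (sq_nonneg q)
    _ = (2 * l + 4 * q) * (q * klFun (l / q)) := by field_simp

section Weighted

variable {s : Type*} [Fintype s] {l q : s → ℝ}

theorem sum_sq_mul_klFun_div {w : s → ℝ} (hw : ∀ i, w i ≠ 0 → q i = 0 → l i = 0)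
    (hmass : ∑ i, w i ^ 2 * l i = ∑ i, w i ^ 2 * q i) :
    ∑ i, w i ^ 2 * (q i * klFun (l i / q i)) = ∑ i, w i ^ 2 * (l i * (log (l i) - log (q i))) := by
  have h : ∀ i, w i ^ 2 * (q i * klFun (l i / q i)) =
      w i ^ 2 * (l i * (log (l i) - log (q i))) - w i ^ 2 * l i + w i ^ 2 * q i := fun i => by
    by_cases hwi : w i = 0
    · simp [hwi]
    rw [mul_klFun_div (hw i hwi)]
    ring
  simp only [h]
  rw [sum_add_distrib, sum_sub_distrib, hmass, sub_add_cancel]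

/- The Cauchy-Schwarz weight `(l + 2 * q) / 3` is dictated by `three_mul_sub_one_sq_le_mul_klFun`;
it yields Pinsker's inequality with the optimal constant. -/
theorem sq_sum_abs_sub_mul_le {w k : s → ℝ} {c : ℝ} (hl : ∀ i, 0 ≤ l i) (hq : ∀ i, 0 ≤ q i)
    (hw : ∀ i, w i ≠ 0 → q i = 0 → l i = 0)
    (hmass : ∑ i, w i ^ 2 * l i = ∑ i, w i ^ 2 * q i)
    (hlc : ∑ i, l i * k i ^ 2 ≤ c) (hqc : ∑ i, q i * k i ^ 2 ≤ c) :
    (∑ i, |l i - q i| * (w i * k i)) ^ 2 ≤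
      2 * (∑ i, w i ^ 2 * (l i * (log (l i) - log (q i)))) * c := by
  let f : s → ℝ := fun i => w i ^ 2 * (q i * klFun (l i / q i))
  let g : s → ℝ := fun i => 2 * (l i + 2 * q i) / 3 * k i ^ 2
  have hf0 : ∀ i, 0 ≤ f i := fun i =>
    mul_nonneg (sq_nonneg _) (mul_nonneg (hq i) (klFun_nonneg (div_nonneg (hl i) (hq i))))
  have hg0 : ∀ i, 0 ≤ g i := fun i => by
    have := hl i
    have := hq i
    positivity
  have hfg : ∀ i, (|l i - q i| * (w i * k i)) ^ 2 ≤ f i * g i := fun i => by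
    by_cases hwi : w i = 0
    · simp [f, hwi]
    have h := mul_le_mul_of_nonneg_left (three_mul_sub_sq_le_mul_klFun_div (hl i) (hq i) (hw i hwi))
      (by positivity : 0 ≤ w i ^ 2 * k i ^ 2)
    rw [mul_pow, sq_abs, mul_pow]
    simp only [f, g]
    linarith
  have hg : ∑ i, g i ≤ 2 * c := by
    have : ∑ i, g i = 2 / 3 * (∑ i, l i * k i ^ 2 + 2 * ∑ i, q i * k i ^ 2) := by
      rw [mul_sum, ← sum_add_distrib, mul_sum]
      exact sum_congr rfl fun i _ => by ring
    linarith
  calc (∑ i, |l i - q i| * (w i * k i)) ^ 2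
      ≤ (∑ i, f i) * ∑ i, g i :=
        sum_sq_le_sum_mul_sum_of_sq_le_mul _ (fun i _ => hf0 i) (fun i _ => hg0 i)
          fun i _ => hfg i
    _ ≤ (∑ i, f i) * (2 * c) := mul_le_mul_of_nonneg_left hg (sum_nonneg fun i _ => hf0 i)
    _ = _ := by
        rw [sum_sq_mul_klFun_div hw hmass]
        ring

theorem sq_norm_sum_sub_mul_le {u k : s → ℂ} {c : ℝ} (hl : ∀ i, 0 ≤ l i) (hq : ∀ i, 0 ≤ q i)
    (hu : ∀ i, u i ≠ 0 → q i = 0 → l i = 0)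
    (hmass : ∑ i, ‖u i‖ ^ 2 * l i = ∑ i, ‖u i‖ ^ 2 * q i)
    (hlc : ∑ i, l i * ‖k i‖ ^ 2 ≤ c) (hqc : ∑ i, q i * ‖k i‖ ^ 2 ≤ c) :
    ‖∑ i, ((l i - q i : ℝ) : ℂ) * (u i * k i)‖ ^ 2 ≤
      2 * (∑ i, ‖u i‖ ^ 2 * (l i * (log (l i) - log (q i)))) * c := by
  refine le_trans ?_ (sq_sum_abs_sub_mul_le hl hq (fun i hi => hu i (norm_ne_zero_iff.1 hi))
    hmass hlc hqc)
  gcongr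
  refine norm_sum_le_of_le _ fun i _ => ?_
  rw [norm_mul, norm_mul, Complex.norm_real, norm_eq_abs]

end Weighted

end Pinsker

section MatrixPinsker

open Matrix

variable {ι : Type*} [Fintype ι]

theorem mul_conjTranspose_self_apply (Y : Matrix ι ι ℂ) (j : ι) :
    (Y * Yᴴ) j j = ((∑ i, ‖Y j i‖ ^ 2 : ℝ) : ℂ) := by
  simp only [mul_apply, conjTranspose_apply, RCLike.star_def, Complex.mul_conj']
  push_cast
  rfl

theorem conjTranspose_mul_self_apply (Y : Matrix ι ι ℂ) (i : ι) :
    (Yᴴ * Y) i i = ((∑ j, ‖Y j i‖ ^ 2 : ℝ) : ℂ) := by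
  simp only [mul_apply, conjTranspose_apply, RCLike.star_def, Complex.conj_mul']
  push_cast
  rfl

variable [DecidableEq ι] {D : Matrix ι ι ℂ}

theorem sum_row_sq_norm_unitary (U : unitaryGroup ι ℂ) (j : ι) :
    ∑ i, ‖(U : Matrix ι ι ℂ) j i‖ ^ 2 = 1 := by
  have h := mul_conjTranspose_self_apply (U : Matrix ι ι ℂ) j
  rw [← star_eq_conjTranspose, Unitary.mul_star_self_of_mem U.2, one_apply_eq] at h
  exact_mod_cast h.symm

theorem sum_col_sq_norm_unitary (U : unitaryGroup ι ℂ) (i : ι) :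
    ∑ j, ‖(U : Matrix ι ι ℂ) j i‖ ^ 2 = 1 := by
  have h := conjTranspose_mul_self_apply (U : Matrix ι ι ℂ) i
  rw [← star_eq_conjTranspose, Unitary.star_mul_self_of_mem U.2, one_apply_eq] at h
  exact_mod_cast h.symm

theorem trace_mul_eq_sum_eigenvalues (hD : D.IsHermitian) (X : Matrix ι ι ℂ) :
    (D * X).trace = ∑ i, (hD.eigenvalues i : ℂ) *
      ((hD.eigenvectorUnitary : Matrix ι ι ℂ)ᴴ * (X * hD.eigenvectorUnitary)) i i := by
  conv_lhs => rw [hD.spectral_theorem, Unitary.conjStarAlgAut_apply]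
  rw [mul_assoc, mul_assoc, trace_mul_comm, mul_assoc, mul_assoc]
  simp only [trace, diag_apply, diagonal_mul, Function.comp_apply, Complex.coe_algebraMap,
    star_eq_conjTranspose]

theorem diag_eq_sum_eigenvalues (hD : D.IsHermitian) (j : ι) :
    D j j =
      ((∑ i, ‖(hD.eigenvectorUnitary : Matrix ι ι ℂ) j i‖ ^ 2 * hD.eigenvalues i : ℝ) : ℂ) := by
  conv_lhs => rw [hD.spectral_theorem, Unitary.conjStarAlgAut_apply]
  rw [mul_apply, Complex.ofReal_sum]
  refine Finset.sum_congr rfl fun i _ => ?_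
  rw [mul_diagonal, star_apply, RCLike.star_def, mul_right_comm, Complex.mul_conj']
  simp

theorem trace_mul_conjTranspose_mul_self_re (hD : D.IsHermitian) (X : Matrix ι ι ℂ) :
    (D * (Xᴴ * X)).trace.re =
      ∑ i, ∑ j, hD.eigenvalues i * ‖(X * (hD.eigenvectorUnitary : Matrix ι ι ℂ)) j i‖ ^ 2 := by
  have h : ∀ i, ((hD.eigenvectorUnitary : Matrix ι ι ℂ)ᴴ * (Xᴴ * X * hD.eigenvectorUnitary)) i i =
      ((∑ j, ‖(X * (hD.eigenvectorUnitary : Matrix ι ι ℂ)) j i‖ ^ 2 : ℝ) : ℂ) := fun i => by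
    rw [← conjTranspose_mul_self_apply, conjTranspose_mul]
    simp only [mul_assoc]
  rw [trace_mul_eq_sum_eigenvalues hD]
  simp only [h, ← Complex.ofReal_mul, ← Complex.ofReal_sum, Complex.ofReal_re, Finset.mul_sum]

theorem trace_diagonal_mul_mul_conjTranspose_self_re (q : ι → ℝ) (X : Matrix ι ι ℂ)
    (U : unitaryGroup ι ℂ) :
    (diagonal (fun j => (q j : ℂ)) * (X * Xᴴ)).trace.re =
      ∑ i, ∑ j, q j * ‖(X * (U : Matrix ι ι ℂ)) j i‖ ^ 2 := by
  have h : ∀ j, (X * Xᴴ) j j = ((∑ i, ‖(X * (U : Matrix ι ι ℂ)) j i‖ ^ 2 : ℝ) : ℂ) := fun j => by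
    rw [← mul_conjTranspose_self_apply, conjTranspose_mul, mul_assoc, ← mul_assoc U.1 _ Xᴴ,
      ← star_eq_conjTranspose U.1, Unitary.mul_star_self_of_mem U.2, one_mul]
  rw [Finset.sum_comm]
  simp only [trace, diag_apply, diagonal_mul, h, ← Complex.ofReal_mul, ← Complex.ofReal_sum,
    Complex.ofReal_re, Finset.mul_sum]

theorem trace_sub_trace_diagonal_eq_sum (hD : D.IsHermitian) (q : ι → ℝ) (X : Matrix ι ι ℂ) :
    (D * X).trace - (diagonal (fun j => (q j : ℂ)) * X).trace =
      ∑ i, ∑ j, ((hD.eigenvalues i - q j : ℝ) : ℂ) *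
        (star ((hD.eigenvectorUnitary : Matrix ι ι ℂ) j i) *
          (X * (hD.eigenvectorUnitary : Matrix ι ι ℂ)) j i) := by
  have hX : ∀ j, X j j = ∑ i, star ((hD.eigenvectorUnitary : Matrix ι ι ℂ) j i) *
      (X * (hD.eigenvectorUnitary : Matrix ι ι ℂ)) j i := fun j => by
    have h : X = X * (hD.eigenvectorUnitary : Matrix ι ι ℂ) *
        star (hD.eigenvectorUnitary : Matrix ι ι ℂ) := by
      rw [mul_assoc, Unitary.mul_star_self_of_mem hD.eigenvectorUnitary.2, mul_one]
    conv_lhs => rw [h, mul_apply]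
    exact Finset.sum_congr rfl fun i _ => mul_comm _ _
  simp only [Complex.ofReal_sub, sub_mul, Finset.sum_sub_distrib]
  congr 1
  · rw [trace_mul_eq_sum_eigenvalues hD X]
    refine Finset.sum_congr rfl fun i _ => ?_
    rw [Matrix.mul_apply, Finset.mul_sum]
    rfl
  · rw [Finset.sum_comm]
    simp only [trace, diag_apply, diagonal_mul, hX, Finset.mul_sum]

theorem sum_sq_norm_mul_log_sub_log (hD : D.IsHermitian) (q : ι → ℝ) :
    ∑ i, ∑ j, ‖(hD.eigenvectorUnitary : Matrix ι ι ℂ) j i‖ ^ 2 *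
        (hD.eigenvalues i * (Real.log (hD.eigenvalues i) - Real.log (q j))) =
      -∑ j, (D j j).re * Real.log (q j) - ∑ i, Real.negMulLog (hD.eigenvalues i) := by
  simp only [mul_sub, Finset.sum_sub_distrib, ← Finset.sum_mul, sum_col_sq_norm_unitary, one_mul]
  rw [Finset.sum_comm]
  simp only [diag_eq_sum_eigenvalues hD, Complex.ofReal_re, Finset.sum_mul, mul_assoc,
    Real.negMulLog, neg_mul, Finset.sum_neg_distrib]
  ring

theorem sq_norm_trace_sub_trace_diagonal_le (hD : D.PosSemidef) {q : ι → ℝ} (hq : ∀ j, 0 ≤ q j)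
    (htr : D.trace = ∑ j, (q j : ℂ)) (hsupp : ∀ j, q j = 0 → D j j = 0) {X : Matrix ι ι ℂ} {c : ℝ}
    (hDX : (D * (Xᴴ * X)).trace.re ≤ c)
    (hqX : (diagonal (fun j => (q j : ℂ)) * (X * Xᴴ)).trace.re ≤ c) :
    ‖(D * X).trace - (diagonal (fun j => (q j : ℂ)) * X).trace‖ ^ 2 ≤
      2 * (-∑ j, (D j j).re * Real.log (q j) -
        ∑ i, Real.negMulLog (hD.isHermitian.eigenvalues i)) * c := by
  set l := hD.isHermitian.eigenvalues with hl_def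
  set U := hD.isHermitian.eigenvectorUnitary with hU_def
  have hl : ∀ i, 0 ≤ l i := hD.eigenvalues_nonneg
  have hsupp' : ∀ i j, (U : Matrix ι ι ℂ) j i ≠ 0 → q j = 0 → l i = 0 := fun i j hU hqj => by
    have h := hsupp j hqj
    rw [diag_eq_sum_eigenvalues hD.isHermitian, Complex.ofReal_eq_zero,
      Finset.sum_eq_zero_iff_of_nonneg fun i _ => mul_nonneg (sq_nonneg _) (hl i)] at h
    exact (mul_eq_zero.1 (h i (Finset.mem_univ i))).resolve_left
      (pow_ne_zero 2 (norm_ne_zero_iff.2 hU))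
  have hmass : ∑ i, ∑ j, ‖(U : Matrix ι ι ℂ) j i‖ ^ 2 * l i =
      ∑ i, ∑ j, ‖(U : Matrix ι ι ℂ) j i‖ ^ 2 * q j := by
    rw [Finset.sum_comm (f := fun i j => ‖(U : Matrix ι ι ℂ) j i‖ ^ 2 * q j)]
    simp only [← Finset.sum_mul, sum_col_sq_norm_unitary, sum_row_sq_norm_unitary, one_mul]
    rw [hD.isHermitian.trace_eq_sum_eigenvalues] at htr
    exact Complex.ofReal_injective (by push_cast; exact htr)
  have h := sq_norm_sum_sub_mul_le (s := ι × ι) (l := fun s => l s.1) (q := fun s => q s.2)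
    (u := fun s => star ((U : Matrix ι ι ℂ) s.2 s.1))
    (k := fun s => (X * (U : Matrix ι ι ℂ)) s.2 s.1) (c := c) (fun s => hl s.1) (fun s => hq s.2)
    (fun s hs => hsupp' s.1 s.2 (star_ne_zero.1 hs))
  simp only [Fintype.sum_prod_type, norm_star] at h
  rw [trace_sub_trace_diagonal_eq_sum hD.isHermitian, ← sum_sq_norm_mul_log_sub_log]
  refine h hmass ?_ ?_
  · rwa [← trace_mul_conjTranspose_mul_self_re]
  · rwa [← trace_diagonal_mul_mul_conjTranspose_self_re]

end MatrixPinsker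

section States

variable {𝒜 : Type*} [CStarAlgebra 𝒜] {φ : StrongDual ℂ 𝒜}

theorem IsState.nontrivial (hφ : IsState φ) : Nontrivial 𝒜 := by
  refine ⟨1, 0, fun h => one_ne_zero (α := ℂ) ?_⟩
  rw [← hφ.map_one, h, map_zero]

theorem IsState.map_star (hφ : IsState φ) (a : 𝒜) : φ (star a) = star (φ a) := by
  let := CStarAlgebra.spectralOrder 𝒜
  let := CStarAlgebra.spectralOrderedRing 𝒜
  refine StarHomClass.map_star (PositiveLinearMap.mk₀ φ.toLinearMap fun x hx => ?_) a
  obtain ⟨b, rfl⟩ := CStarAlgebra.nonneg_iff_eq_star_mul_self.1 hx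
  exact hφ.nonneg b

theorem IsState.re_star_mul_self_le (hφ : IsState φ) (a : 𝒜) :
    (φ (star a * a)).re ≤ ‖a‖ ^ 2 := by
  let := CStarAlgebra.spectralOrder 𝒜
  let := CStarAlgebra.spectralOrderedRing 𝒜
  have h : 0 ≤ algebraMap ℝ 𝒜 (‖a‖ ^ 2) - star a * a :=
    sub_nonneg.2 CStarAlgebra.star_mul_le_algebraMap_norm_sq
  obtain ⟨b, hb⟩ := CStarAlgebra.nonneg_iff_eq_star_mul_self.1 h
  have hreal : algebraMap ℝ 𝒜 (‖a‖ ^ 2) = ((‖a‖ ^ 2 : ℝ) : ℂ) • (1 : 𝒜) := by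
    rw [Algebra.algebraMap_eq_smul_one, Complex.coe_smul]
  have hpos := hφ.nonneg b
  rw [← hb, hreal, map_sub, map_smul, hφ.map_one, smul_eq_mul, mul_one, sub_nonneg] at hpos
  exact (Complex.le_def.1 hpos).1

end States

section MatrixSubalgebras

open Matrix

variable {𝒜 : Type*} [CStarAlgebra 𝒜] {φ : StrongDual ℂ 𝒜}
variable {ι κ : Type*} [Fintype ι] [DecidableEq ι] [Fintype κ] [DecidableEq κ]

/-- The density matrix of the functional `φ ∘ π` on a matrix algebra, with respect to the trace.
Unlike `densityMatrix` it is attached to a representation `π`, so that it can be used without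
choosing an identification of the range of `π` with matrices over `Fin n`. -/
noncomputable def repDensity (π : Matrix ι ι ℂ →⋆ₐ[ℂ] 𝒜) (φ : StrongDual ℂ 𝒜) : Matrix ι ι ℂ :=
  of fun i j => φ (π (single j i 1))

theorem trace_repDensity_mul (π : Matrix ι ι ℂ →⋆ₐ[ℂ] 𝒜) (φ : StrongDual ℂ 𝒜)
    (X : Matrix ι ι ℂ) : (repDensity π φ * X).trace = φ (π X) := by
  have hsmul : ∀ i j (c : ℂ), φ (π (single i j c)) = c * φ (π (single i j 1)) := fun i j c => by
    rw [← smul_eq_mul, ← map_smul, ← map_smul, smul_single, smul_eq_mul, mul_one]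
  conv_rhs => rw [matrix_eq_sum_single X]
  simp only [trace, diag, Matrix.mul_apply, map_sum, repDensity, of_apply]
  rw [Finset.sum_comm]
  refine Finset.sum_congr rfl fun i _ => Finset.sum_congr rfl fun j _ => ?_
  rw [hsmul i j (X i j), mul_comm]

theorem trace_repDensity (hφ : IsState φ) (π : Matrix ι ι ℂ →⋆ₐ[ℂ] 𝒜) :
    (repDensity π φ).trace = 1 := by
  rw [← mul_one (repDensity π φ), trace_repDensity_mul, map_one, hφ.map_one]

open scoped MatrixOrder Matrix.Norms.L2Operator in
theorem repDensity_posSemidef (hφ : IsState φ) (π : Matrix ι ι ℂ →⋆ₐ[ℂ] 𝒜) :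
    (repDensity π φ).PosSemidef := by
  refine posSemidef_iff_dotProduct_mulVec.2 ⟨?_, fun x => ?_⟩
  · ext i j
    rw [conjTranspose_apply, repDensity, of_apply, of_apply, ← hφ.map_star, ← map_star,
      star_eq_conjTranspose, conjTranspose_single, star_one]
  · obtain ⟨Y, hY⟩ :=
      CStarAlgebra.nonneg_iff_eq_star_mul_self.1 (posSemidef_vecMulVec_self_star x).nonneg
    rw [dotProduct_comm, ← trace_vecMulVec, ← mul_vecMulVec, hY, trace_repDensity_mul, map_mul,
      map_star]
    exact hφ.nonneg _

theorem repDensity_comp (π : Matrix ι ι ℂ →⋆ₐ[ℂ] 𝒜) (φ : StrongDual ℂ 𝒜)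
    (α : Matrix κ κ ℂ ≃⋆ₐ[ℂ] Matrix ι ι ℂ) :
    repDensity (π.comp (α : Matrix κ κ ℂ →⋆ₐ[ℂ] Matrix ι ι ℂ)) φ = α.symm (repDensity π φ) := by
  refine ext_iff_trace_mul_right.2 fun X => ?_
  rw [trace_repDensity_mul, ← α.symm_apply_apply X, ← map_mul, Matrix.trace_map α.symm,
    trace_repDensity_mul]
  simp

theorem trace_mul_cfc_log {D : Matrix ι ι ℂ} (hD : D.IsHermitian) :
    (D * cfc Real.log D).trace.re = ∑ i, hD.eigenvalues i * Real.log (hD.eigenvalues i) := by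
  have hU := Unitary.star_mul_self_of_mem hD.eigenvectorUnitary.2
  have hlog : star hD.eigenvectorUnitary.1 * (cfc Real.log D * hD.eigenvectorUnitary.1) =
      diagonal fun i => (Real.log (hD.eigenvalues i) : ℂ) := by
    rw [hD.cfc_eq, IsHermitian.cfc, Unitary.conjStarAlgAut_apply, Matrix.mul_assoc, hU, mul_one,
      ← Matrix.mul_assoc, hU, one_mul]
    rfl
  rw [trace_mul_eq_sum_eigenvalues hD]
  simp only [← star_eq_conjTranspose, hlog, diagonal_apply_eq, ← Complex.ofReal_mul,
    ← Complex.ofReal_sum, Complex.ofReal_re]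

theorem matrixHom_injective [Nontrivial 𝒜] (π : Matrix ι ι ℂ →⋆ₐ[ℂ] 𝒜) :
    Function.Injective π := by
  rcases isEmpty_or_nonempty ι with h | h
  · exact Function.injective_of_subsingleton _
  · exact RingHom.injective (π : Matrix ι ι ℂ →+* 𝒜)

/-- Relabelling of rows and columns as an isomorphism of ⋆-algebras. -/
def reindexStarAlgEquiv (e : ι ≃ κ) : Matrix ι ι ℂ ≃⋆ₐ[ℂ] Matrix κ κ ℂ :=
  .ofAlgEquiv (reindexAlgEquiv ℂ ℂ e) fun X => by
    ext i j
    simp [star_eq_conjTranspose]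

theorem cfc_log_map (α : Matrix ι ι ℂ ≃⋆ₐ[ℂ] Matrix κ κ ℂ) {D : Matrix ι ι ℂ}
    (hD : D.IsHermitian) : cfc Real.log (α D) = α (cfc Real.log D) :=
  (StarAlgHomClass.map_cfc (S := ℂ) α Real.log D (finite_real_spectrum.continuousOn _)
    (LinearMap.continuous_of_finiteDimensional α.toAlgEquiv.toLinearMap) hD
    (IsSelfAdjoint.map hD α)).symm

theorem vonNeumannEntropy_range (hφ : IsState φ) (π : Matrix ι ι ℂ →⋆ₐ[ℂ] 𝒜) :
    vonNeumannEntropy π.range φ =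
      ∑ i, Real.negMulLog ((repDensity_posSemidef hφ π).isHermitian.eigenvalues i) := by
  have := hφ.nontrivial
  let ε : Matrix ι ι ℂ ≃⋆ₐ[ℂ] π.range := StarAlgEquiv.ofInjective π (matrixHom_injective π)
  have hD := (repDensity_posSemidef hφ π).isHermitian
  have h : ∃ n : ℕ, Nonempty (π.range ≃⋆ₐ[ℂ] Matrix (Fin n) (Fin n) ℂ) :=
    ⟨Fintype.card ι, ⟨ε.symm.trans (reindexStarAlgEquiv (Fintype.equivFin ι))⟩⟩
  rw [vonNeumannEntropy, dif_pos h]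
  generalize h.choose_spec.some = e
  have hdensity : densityMatrix e φ = (ε.trans e) (repDensity π φ) := by
    rw [← (ε.trans e).symm_symm, ← repDensity_comp]
    ext i j
    change φ (e.symm (single j i 1) : 𝒜) = φ ((ε (ε.symm (e.symm (single j i 1))) : π.range) : 𝒜)
    rw [ε.apply_symm_apply]
  rw [hdensity, cfc_log_map _ hD, ← map_mul, Matrix.trace_map (ε.trans e), trace_mul_cfc_log hD]
  simp only [Real.negMulLog, neg_mul, Finset.sum_neg_distrib]

end MatrixSubalgebras

section MatrixAlgebras

variable {𝒜 : Type*} [CStarAlgebra 𝒜] {φ : StrongDual ℂ 𝒜} {B : StarSubalgebra ℂ 𝒜}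
variable {ι : Type*} [Fintype ι] [DecidableEq ι]

/-- A unital ⋆-subalgebra which is the image of a full matrix algebra. As matrix algebras are simple
this is the same as being isomorphic to one, unless `𝒜` is trivial. -/
def IsMatrixAlgebra (B : StarSubalgebra ℂ 𝒜) : Prop :=
  ∃ (n : ℕ) (π : Matrix (Fin n) (Fin n) ℂ →⋆ₐ[ℂ] 𝒜), π.range = B

theorem range_comp_of_surjective {R S T : Type*} [Ring R] [StarRing R] [Algebra ℂ R] [Ring S]
    [StarRing S] [Algebra ℂ S] [Ring T] [StarRing T] [Algebra ℂ T] [StarModule ℂ T]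
    (π : S →⋆ₐ[ℂ] T) {α : R →⋆ₐ[ℂ] S} (hα : Function.Surjective α) :
    (π.comp α).range = π.range :=
  SetLike.coe_injective (hα.range_comp π)

theorem isMatrixAlgebra_range (π : Matrix ι ι ℂ →⋆ₐ[ℂ] 𝒜) : IsMatrixAlgebra π.range := by
  let α := reindexStarAlgEquiv (Fintype.equivFin ι).symm
  refine ⟨Fintype.card ι, π.comp (α : _ →⋆ₐ[ℂ] Matrix ι ι ℂ), range_comp_of_surjective π ?_⟩
  exact EquivLike.surjective α

omit [DecidableEq ι] in
theorem isMatrixAlgebra_of_starAlgEquiv (e : B ≃⋆ₐ[ℂ] Matrix ι ι ℂ) : IsMatrixAlgebra B := by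
  classical
  have hrange := range_comp_of_surjective B.subtype
    (α := (e.symm : Matrix ι ι ℂ →⋆ₐ[ℂ] B)) (EquivLike.surjective e.symm)
  rw [show B.subtype.range = B from SetLike.coe_injective Subtype.range_coe] at hrange
  exact hrange ▸ isMatrixAlgebra_range _

open Matrix in
theorem IsMatrixAlgebra.exists_diagonal (hB : IsMatrixAlgebra B) (hφ : IsState φ) :
    ∃ (n : ℕ) (π : Matrix (Fin n) (Fin n) ℂ →⋆ₐ[ℂ] 𝒜) (l : Fin n → ℝ), π.range = B ∧
      (∀ i, 0 ≤ l i) ∧ repDensity π φ = diagonal (fun i => (l i : ℂ)) ∧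
      vonNeumannEntropy B φ = ∑ i, Real.negMulLog (l i) := by
  obtain ⟨n, π, rfl⟩ := hB
  have hD := repDensity_posSemidef hφ π
  let α : Matrix (Fin n) (Fin n) ℂ ≃⋆ₐ[ℂ] Matrix (Fin n) (Fin n) ℂ :=
    Unitary.conjStarAlgAut ℂ _ hD.isHermitian.eigenvectorUnitary
  have hdiag : repDensity π φ = α (diagonal fun i => (hD.isHermitian.eigenvalues i : ℂ)) :=
    hD.isHermitian.spectral_theorem
  refine ⟨n, π.comp (α : Matrix (Fin n) (Fin n) ℂ →⋆ₐ[ℂ] Matrix (Fin n) (Fin n) ℂ),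
    hD.isHermitian.eigenvalues, range_comp_of_surjective π (EquivLike.surjective α),
    hD.eigenvalues_nonneg, ?_, vonNeumannEntropy_range hφ π⟩
  exact (repDensity_comp π φ α).trans (α.symm_apply_eq.2 hdiag)

theorem range_comp_rangeRestrict {R : Type*} [Ring R] [StarRing R] [Algebra ℂ R]
    (π : R →⋆ₐ[ℂ] 𝒜) (f : π.range →⋆ₐ[ℂ] 𝒜) : (f.comp π.rangeRestrict).range = f.range :=
  range_comp_of_surjective f Set.rangeFactorization_surjective

theorem IsMatrixAlgebra.range (hB : IsMatrixAlgebra B) (f : B →⋆ₐ[ℂ] 𝒜) :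
    IsMatrixAlgebra f.range := by
  obtain ⟨n, π, rfl⟩ := hB
  rw [← range_comp_rangeRestrict]
  exact isMatrixAlgebra_range _

theorem IsMatrixAlgebra.vonNeumannEntropy_range (hB : IsMatrixAlgebra B) (hφ : IsState φ)
    {f : B →⋆ₐ[ℂ] 𝒜} (hf : ∀ b : B, φ (f b) = φ b) :
    vonNeumannEntropy f.range φ = vonNeumannEntropy B φ := by
  obtain ⟨n, π, rfl⟩ := hB
  have hdensity : repDensity (f.comp π.rangeRestrict) φ = repDensity π φ := by
    ext i j
    exact hf _
  rw [← range_comp_rangeRestrict, QuantumLattice.vonNeumannEntropy_range hφ,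
    QuantumLattice.vonNeumannEntropy_range hφ]
  simp only [hdensity]

end MatrixAlgebras

section TensorProducts

open Matrix
open scoped Kronecker TensorProduct

variable {𝒜 : Type*} [CStarAlgebra 𝒜] {φ ω : StrongDual ℂ 𝒜} {B₁ B₂ : StarSubalgebra ℂ 𝒜}
variable {ι κ : Type*} [Fintype ι] [DecidableEq ι] [Fintype κ] [DecidableEq κ]
variable {R S : Type*} [Ring R] [StarRing R] [Algebra ℂ R] [StarModule ℂ R] [Ring S] [StarRing S]
  [Algebra ℂ S] [StarModule ℂ S]

/-- The ⋆-homomorphism on the algebraic tensor product given by two commuting ⋆-homomorphisms. -/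
noncomputable def tensorLift (f : R →⋆ₐ[ℂ] 𝒜) (g : S →⋆ₐ[ℂ] 𝒜) (h : ∀ a b, Commute (f a) (g b)) :
    R ⊗[ℂ] S →⋆ₐ[ℂ] 𝒜 where
  toAlgHom := Algebra.TensorProduct.lift f.toAlgHom g.toAlgHom h
  map_star' x := by
    let T := Algebra.TensorProduct.lift f.toAlgHom g.toAlgHom h
    change T (star x) = star (T x)
    induction x with
    | zero => simp only [star_zero, map_zero]
    | add x y hx hy => rw [star_add, map_add, map_add, star_add, hx, hy]
    | tmul a b =>
      have hT : ∀ a b, T (a ⊗ₜ b) = f a * g b := Algebra.TensorProduct.lift_tmul _ _ h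
      rw [TensorProduct.star_tmul, hT, hT, (h a b).eq, star_mul, map_star, map_star]

theorem tensorLift_tmul (f : R →⋆ₐ[ℂ] 𝒜) (g : S →⋆ₐ[ℂ] 𝒜)
    (h : ∀ a b, Commute (f a) (g b)) (a : R) (b : S) : tensorLift f g h (a ⊗ₜ b) = f a * g b :=
  Algebra.TensorProduct.lift_tmul f.toAlgHom g.toAlgHom h a b

theorem range_tensorLift (f : R →⋆ₐ[ℂ] 𝒜) (g : S →⋆ₐ[ℂ] 𝒜)
    (h : ∀ a b, Commute (f a) (g b)) : (tensorLift f g h).range = f.range ⊔ g.range := by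
  refine le_antisymm ?_ (sup_le ?_ ?_)
  · rintro _ ⟨x, rfl⟩
    change tensorLift f g h x ∈ _
    induction x with
    | zero => rw [map_zero]; exact zero_mem _
    | add x y hx hy => rw [map_add]; exact add_mem hx hy
    | tmul a b =>
      rw [tensorLift_tmul]
      exact StarSubalgebra.mul_mem_sup ⟨a, rfl⟩ ⟨b, rfl⟩
  · rintro _ ⟨a, rfl⟩
    exact ⟨a ⊗ₜ 1, (tensorLift_tmul f g h a 1).trans (by rw [map_one, mul_one]; rfl)⟩
  · rintro _ ⟨b, rfl⟩
    exact ⟨1 ⊗ₜ b, (tensorLift_tmul f g h 1 b).trans (by rw [map_one, one_mul]; rfl)⟩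

/-- The representation of the matrices over a product index set given by two commuting
representations of matrix algebras. -/
noncomputable def prodRep (π₁ : Matrix ι ι ℂ →⋆ₐ[ℂ] 𝒜) (π₂ : Matrix κ κ ℂ →⋆ₐ[ℂ] 𝒜)
    (h : ∀ a b, Commute (π₁ a) (π₂ b)) : Matrix (ι × κ) (ι × κ) ℂ →⋆ₐ[ℂ] 𝒜 :=
  (tensorLift π₁ π₂ h).comp
    ((kroneckerStarAlgEquiv ι κ ℂ).symm : Matrix (ι × κ) (ι × κ) ℂ →⋆ₐ[ℂ] _)

variable {π₁ : Matrix ι ι ℂ →⋆ₐ[ℂ] 𝒜} {π₂ : Matrix κ κ ℂ →⋆ₐ[ℂ] 𝒜}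

theorem prodRep_kronecker (h : ∀ a b, Commute (π₁ a) (π₂ b)) (a : Matrix ι ι ℂ)
    (b : Matrix κ κ ℂ) : prodRep π₁ π₂ h (a ⊗ₖ b) = π₁ a * π₂ b := by
  have hsymm : (kroneckerStarAlgEquiv ι κ ℂ).symm (a ⊗ₖ b) = a ⊗ₜ b := by
    rw [StarAlgEquiv.symm_apply_eq]
    simp
  rw [← tensorLift_tmul π₁ π₂ h, ← hsymm]
  rfl

theorem range_prodRep (h : ∀ a b, Commute (π₁ a) (π₂ b)) :
    (prodRep π₁ π₂ h).range = π₁.range ⊔ π₂.range := by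
  rw [← range_tensorLift π₁ π₂ h]
  exact range_comp_of_surjective _ (EquivLike.surjective (kroneckerStarAlgEquiv ι κ ℂ).symm)

theorem repDensity_prodRep_apply (h : ∀ a b, Commute (π₁ a) (π₂ b)) (i j : ι) (k l : κ) :
    repDensity (prodRep π₁ π₂ h) φ (i, k) (j, l) = φ (π₁ (single j i 1) * π₂ (single l k 1)) := by
  rw [← prodRep_kronecker h, single_kronecker_single, mul_one]
  rfl

theorem repDensity_prodRep (h : ∀ a b, Commute (π₁ a) (π₂ b))
    (hω : ∀ a b, ω (π₁ a * π₂ b) = φ (π₁ a) * φ (π₂ b)) :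
    repDensity (prodRep π₁ π₂ h) ω = repDensity π₁ φ ⊗ₖ repDensity π₂ φ := by
  ext ⟨i, k⟩ ⟨j, l⟩
  rw [repDensity_prodRep_apply, hω]
  rfl

theorem sum_repDensity_prodRep_right (h : ∀ a b, Commute (π₁ a) (π₂ b)) (i : ι) :
    ∑ k, repDensity (prodRep π₁ π₂ h) φ (i, k) (i, k) = repDensity π₁ φ i i := by
  simp only [repDensity_prodRep_apply]
  rw [← map_sum, ← Finset.mul_sum, ← map_sum, sum_single_one, map_one, mul_one]
  rfl

theorem sum_repDensity_prodRep_left (h : ∀ a b, Commute (π₁ a) (π₂ b)) (k : κ) :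
    ∑ i, repDensity (prodRep π₁ π₂ h) φ (i, k) (i, k) = repDensity π₂ φ k k := by
  simp only [repDensity_prodRep_apply]
  rw [← map_sum, ← Finset.sum_mul, ← map_sum, sum_single_one, map_one, one_mul]
  rfl

theorem IsMatrixAlgebra.sup (h₁ : IsMatrixAlgebra B₁) (h₂ : IsMatrixAlgebra B₂)
    (h : ∀ a ∈ B₁, ∀ b ∈ B₂, Commute a b) : IsMatrixAlgebra (B₁ ⊔ B₂) := by
  obtain ⟨m, π₁, rfl⟩ := h₁
  obtain ⟨n, π₂, rfl⟩ := h₂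
  rw [← range_prodRep fun a b => h _ ⟨a, rfl⟩ _ ⟨b, rfl⟩]
  exact isMatrixAlgebra_range _

theorem eqOn_sup_of_eq_on_mul (h₁ : IsMatrixAlgebra B₁) (h₂ : IsMatrixAlgebra B₂)
    (h : ∀ a ∈ B₁, ∀ b ∈ B₂, Commute a b) (hω : ∀ a ∈ B₁, ∀ b ∈ B₂, ω (a * b) = φ (a * b)) :
    Set.EqOn ω φ (B₁ ⊔ B₂ : StarSubalgebra ℂ 𝒜) := by
  obtain ⟨m, π₁, rfl⟩ := h₁
  obtain ⟨n, π₂, rfl⟩ := h₂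
  have hcomm : ∀ a b, Commute (π₁ a) (π₂ b) := fun a b => h _ ⟨a, rfl⟩ _ ⟨b, rfl⟩
  rw [← range_prodRep hcomm]
  rintro _ ⟨X, rfl⟩
  have hdensity : repDensity (prodRep π₁ π₂ hcomm) ω = repDensity (prodRep π₁ π₂ hcomm) φ := by
    ext ⟨i, k⟩ ⟨j, l⟩
    rw [repDensity_prodRep_apply, repDensity_prodRep_apply]
    exact hω _ ⟨_, rfl⟩ _ ⟨_, rfl⟩
  change ω (prodRep π₁ π₂ hcomm X) = φ (prodRep π₁ π₂ hcomm X)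
  rw [← trace_repDensity_mul, hdensity, trace_repDensity_mul]

end TensorProducts

section Products

open Matrix
open scoped Kronecker

variable {𝒜 : Type*} [CStarAlgebra 𝒜] {φ ω : StrongDual ℂ 𝒜} {B B₁ B₂ : StarSubalgebra ℂ 𝒜}
variable {ι κ : Type*} [Fintype ι] [Fintype κ]

theorem sum_mul_log_mul_marginals {d : ι × κ → ℝ} (hd : ∀ s, 0 ≤ d s) {l : ι → ℝ} {q : κ → ℝ}
    (hl : ∀ i, ∑ k, d (i, k) = l i) (hq : ∀ k, ∑ i, d (i, k) = q k) :
    ∑ s, d s * Real.log (l s.1 * q s.2) =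
      ∑ i, l i * Real.log (l i) + ∑ k, q k * Real.log (q k) := by
  have hle₁ : ∀ s, d s ≤ l s.1 := fun s =>
    hl s.1 ▸ Finset.single_le_sum (f := fun k => d (s.1, k)) (fun _ _ => hd _) (Finset.mem_univ s.2)
  have hle₂ : ∀ s, d s ≤ q s.2 := fun s =>
    hq s.2 ▸ Finset.single_le_sum (f := fun i => d (i, s.2)) (fun _ _ => hd _) (Finset.mem_univ s.1)
  have hlog : ∀ s, d s * Real.log (l s.1 * q s.2) =
      d s * Real.log (l s.1) + d s * Real.log (q s.2) := fun s => by
    rcases (hd s).eq_or_lt with hs | hs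
    · simp only [← hs, zero_mul, add_zero]
    · rw [Real.log_mul (hs.trans_le (hle₁ s)).ne' (hs.trans_le (hle₂ s)).ne', mul_add]
  simp only [hlog, Finset.sum_add_distrib]
  congr 1
  · simp only [Fintype.sum_prod_type, ← Finset.sum_mul, hl]
  · simp only [Fintype.sum_prod_type_right, ← Finset.sum_mul, hq]

theorem eq_zero_of_marginal_mul_eq_zero {d : ι × κ → ℝ} (hd : ∀ s, 0 ≤ d s) {s : ι × κ}
    (h : (∑ k, d (s.1, k)) * ∑ i, d (i, s.2) = 0) : d s = 0 := by
  rcases mul_eq_zero.1 h with h | h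
  · exact (Finset.sum_eq_zero_iff_of_nonneg fun k _ => hd (s.1, k)).1 h s.2 (Finset.mem_univ _)
  · exact (Finset.sum_eq_zero_iff_of_nonneg fun i _ => hd (i, s.2)).1 h s.1 (Finset.mem_univ _)

variable [DecidableEq ι] [DecidableEq κ] {π₁ : Matrix ι ι ℂ →⋆ₐ[ℂ] 𝒜} {π₂ : Matrix κ κ ℂ →⋆ₐ[ℂ] 𝒜}
variable {l : ι → ℝ} {q : κ → ℝ}

theorem sum_re_repDensity_prodRep_right (h : ∀ a b, Commute (π₁ a) (π₂ b))
    (hl : repDensity π₁ φ = diagonal fun i => (l i : ℂ)) (i : ι) :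
    ∑ k, (repDensity (prodRep π₁ π₂ h) φ (i, k) (i, k)).re = l i := by
  rw [← Complex.re_sum, sum_repDensity_prodRep_right h, hl, diagonal_apply_eq, Complex.ofReal_re]

theorem sum_re_repDensity_prodRep_left (h : ∀ a b, Commute (π₁ a) (π₂ b))
    (hq : repDensity π₂ φ = diagonal fun k => (q k : ℂ)) (k : κ) :
    ∑ i, (repDensity (prodRep π₁ π₂ h) φ (i, k) (i, k)).re = q k := by
  rw [← Complex.re_sum, sum_repDensity_prodRep_left h, hq, diagonal_apply_eq, Complex.ofReal_re]

theorem sq_norm_map_prodRep_sub_le (hφ : IsState φ) (hω : IsState ω)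
    (h : ∀ a b, Commute (π₁ a) (π₂ b)) (hl : repDensity π₁ φ = diagonal fun i => (l i : ℂ))
    (hq : repDensity π₂ φ = diagonal fun k => (q k : ℂ))
    (hmul : ∀ a b, ω (π₁ a * π₂ b) = φ (π₁ a) * φ (π₂ b)) (X : Matrix (ι × κ) (ι × κ) ℂ) :
    ‖φ (prodRep π₁ π₂ h X) - ω (prodRep π₁ π₂ h X)‖ ^ 2 ≤
      2 * (∑ i, Real.negMulLog (l i) + ∑ k, Real.negMulLog (q k) -
        vonNeumannEntropy (prodRep π₁ π₂ h).range φ) * ‖prodRep π₁ π₂ h X‖ ^ 2 := by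
  have hsum₁ := sum_re_repDensity_prodRep_right h hl
  have hsum₂ := sum_re_repDensity_prodRep_left h hq
  have hprod : repDensity (prodRep π₁ π₂ h) ω = diagonal fun s => ((l s.1 * q s.2 : ℝ) : ℂ) := by
    simp only [repDensity_prodRep h hmul, hl, hq, diagonal_kronecker_diagonal, Complex.ofReal_mul]
  set π := prodRep π₁ π₂ h
  have hD := repDensity_posSemidef hφ π
  have hdiag : ∀ s, 0 ≤ repDensity π φ s s := fun s => hD.diag_nonneg
  have hd : ∀ s, 0 ≤ (repDensity π φ s s).re := fun s => (Complex.le_def.1 (hdiag s)).1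
  have hent : -∑ s, (repDensity π φ s s).re * Real.log (l s.1 * q s.2) =
      ∑ i, Real.negMulLog (l i) + ∑ k, Real.negMulLog (q k) := by
    rw [sum_mul_log_mul_marginals hd hsum₁ hsum₂]
    simp only [Real.negMulLog, neg_mul, Finset.sum_neg_distrib, neg_add]
  rw [vonNeumannEntropy_range hφ π, ← hent, ← trace_repDensity_mul, ← trace_repDensity_mul, hprod]
  refine sq_norm_trace_sub_trace_diagonal_le hD (fun s => ?_) ?_ (fun s hs => ?_) ?_ ?_
  · rw [← hsum₁, ← hsum₂]
    exact mul_nonneg (Finset.sum_nonneg fun _ _ => hd _) (Finset.sum_nonneg fun _ _ => hd _)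
  · rw [← trace_diagonal, ← hprod, trace_repDensity hω, trace_repDensity hφ]
  · rw [← hsum₁, ← hsum₂] at hs
    exact Complex.ext (eq_zero_of_marginal_mul_eq_zero hd hs) (Complex.le_def.1 (hdiag s)).2.symm
  · rw [trace_repDensity_mul, map_mul, ← star_eq_conjTranspose, map_star]
    exact hφ.re_star_mul_self_le _
  · rw [← hprod, trace_repDensity_mul, map_mul, ← star_eq_conjTranspose, map_star,
      ← norm_star (π X)]
    simpa only [star_star] using hω.re_star_mul_self_le (star (π X))

theorem sq_norm_sub_le_of_map_mul (hφ : IsState φ) (hω : IsState ω) (h₁ : IsMatrixAlgebra B₁)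
    (h₂ : IsMatrixAlgebra B₂) (hcomm : ∀ a ∈ B₁, ∀ b ∈ B₂, Commute a b)
    (hmul : ∀ a ∈ B₁, ∀ b ∈ B₂, ω (a * b) = φ a * φ b) {x : 𝒜} (hx : x ∈ B₁ ⊔ B₂) :
    ‖φ x - ω x‖ ^ 2 ≤ 2 * (vonNeumannEntropy B₁ φ + vonNeumannEntropy B₂ φ -
      vonNeumannEntropy (B₁ ⊔ B₂) φ) * ‖x‖ ^ 2 := by
  obtain ⟨m, π₁, l, rfl, -, hl, hS₁⟩ := h₁.exists_diagonal hφ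
  obtain ⟨n, π₂, q, rfl, -, hq, hS₂⟩ := h₂.exists_diagonal hφ
  have h : ∀ a b, Commute (π₁ a) (π₂ b) := fun a b => hcomm _ ⟨a, rfl⟩ _ ⟨b, rfl⟩
  rw [hS₁, hS₂]
  rw [← range_prodRep h] at hx ⊢
  obtain ⟨X, rfl⟩ := hx
  exact sq_norm_map_prodRep_sub_le hφ hω h hl hq (fun a b => hmul _ ⟨a, rfl⟩ _ ⟨b, rfl⟩) X

theorem single_mul_mul_mul_single (π : Matrix ι ι ℂ →⋆ₐ[ℂ] 𝒜) (X : Matrix ι ι ℂ) {b : 𝒜}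
    (hb : ∀ Y, Commute (π Y) b) (k m : ι) :
    π (single m k 1) * (π X * b) * π (single k m 1) = X k k • (π (single m m 1) * b) := by
  have hcompress : single m k 1 * X * single k m 1 = X k k • single m m (1 : ℂ) := by
    rw [single_mul_mul_single, one_mul, mul_one, smul_single, smul_eq_mul, mul_one]
  calc π (single m k 1) * (π X * b) * π (single k m 1)
      = π (single m k 1) * π X * (b * π (single k m 1)) := by simp only [mul_assoc]
    _ = π (single m k 1 * X * single k m 1) * b := by
      rw [← (hb _).eq, map_mul, map_mul]
      simp only [mul_assoc]
    _ = X k k • (π (single m m 1) * b) := by rw [hcompress, map_smul, smul_mul_assoc]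

theorem exists_isState_map_mul (hφ : IsState φ) (hB : IsMatrixAlgebra B) :
    ∃ ω : StrongDual ℂ 𝒜, IsState ω ∧
      ∀ a ∈ B, ∀ b, (∀ a ∈ B, Commute a b) → ω (a * b) = φ a * φ b := by
  obtain ⟨n, π, l, rfl, hl, hdiag, -⟩ := hB.exists_diagonal hφ
  let ω : StrongDual ℂ 𝒜 := ∑ k, ∑ m, (l k : ℂ) •
    (φ.comp (ContinuousLinearMap.mulLeftRight ℂ 𝒜 (π (single m k 1)) (π (single k m 1))))
  have hω : ∀ x, ω x = ∑ k, ∑ m, (l k : ℂ) * φ (π (single m k 1) * x * π (single k m 1)) := by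
    intro x
    simp [ω]
  have hprod : ∀ a ∈ π.range, ∀ b, (∀ a ∈ π.range, Commute a b) → ω (a * b) = φ a * φ b := by
    rintro _ ⟨X, rfl⟩ b hb
    change ω (π X * b) = φ (π X) * φ b
    have hunit : ∑ m, φ (π (single m m 1) * b) = φ b := by
      rw [← map_sum, ← Finset.sum_mul, ← map_sum, sum_single_one, map_one, one_mul]
    rw [hω, ← trace_repDensity_mul π, hdiag, trace, Finset.sum_mul]
    refine Finset.sum_congr rfl fun k _ => ?_
    simp only [single_mul_mul_mul_single π X fun Y => hb _ ⟨Y, rfl⟩, map_smul, smul_eq_mul]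
    rw [← Finset.mul_sum, ← Finset.mul_sum, hunit, diag_apply, diagonal_mul, mul_assoc]
  refine ⟨ω, ⟨?_, fun a => ?_⟩, hprod⟩
  · have h := hprod 1 (one_mem _) 1 fun _ _ => Commute.one_right _
    rwa [one_mul, hφ.map_one, one_mul] at h
  · rw [hω]
    refine Finset.sum_nonneg fun k _ => Finset.sum_nonneg fun m _ =>
      mul_nonneg (Complex.zero_le_real.2 (hl k)) ?_
    have hstar : π (single m k 1) = star (π (single k m 1)) := by
      rw [← map_star, star_eq_conjTranspose, conjTranspose_single, star_one]
    rw [hstar, ← mul_assoc, mul_assoc _ a, ← star_mul]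
    exact hφ.nonneg _

end Products

section Decoupling

variable {𝒜 : Type*} [CStarAlgebra 𝒜] {φ ω ω' : StrongDual ℂ 𝒜} {B₁ B₂ : StarSubalgebra ℂ 𝒜}
variable {κ : B₂ →⋆ₐ[ℂ] 𝒜}

/-- A decoupling of `B₂` from `B₁` in `φ`: a ⋆-homomorphism of `B₂` onto an algebra which commutes
with `B₁`, generates together with `B₁` the same algebra as `B₂`, and cannot be distinguished from
`B₂` by `φ` or by the products of `φ` over `B₁` and `B₂`. It reduces algebras which need not commute
to commuting ones: for spin systems it is the inclusion of `B₂`, for fermion systems the Klein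
transformation. -/
structure IsDecoupling (φ : StrongDual ℂ 𝒜) (B₁ : StarSubalgebra ℂ 𝒜) (κ : B₂ →⋆ₐ[ℂ] 𝒜) :
    Prop where
  commute : ∀ a ∈ B₁, ∀ b, Commute a (κ b)
  sup_range : B₁ ⊔ κ.range = B₁ ⊔ B₂
  apply_eq : ∀ b : B₂, φ (κ b) = φ b
  map_mul_iff : ∀ ω : StrongDual ℂ 𝒜, (∀ a ∈ B₁, ∀ b : B₂, ω (a * κ b) = φ a * φ b) ↔
    ∀ a ∈ B₁, ∀ b ∈ B₂, ω (a * b) = φ a * φ b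

theorem IsDecoupling.commute_of_mem_range (hκ : IsDecoupling φ B₁ κ) :
    ∀ a ∈ B₁, ∀ b ∈ κ.range, Commute a b := by
  rintro a ha _ ⟨b, rfl⟩
  exact hκ.commute a ha b

theorem IsDecoupling.map_mul_of_mem_range (hκ : IsDecoupling φ B₁ κ)
    (hω : ∀ a ∈ B₁, ∀ b ∈ B₂, ω (a * b) = φ a * φ b) :
    ∀ a ∈ B₁, ∀ b ∈ κ.range, ω (a * b) = φ a * φ b := by
  rintro a ha _ ⟨b, rfl⟩
  exact ((hκ.map_mul_iff ω).2 hω a ha b).trans (congrArg (φ a * ·) (hκ.apply_eq b).symm)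

theorem IsDecoupling.eqOn_sup (hκ : IsDecoupling φ B₁ κ) (h₁ : IsMatrixAlgebra B₁)
    (h₂ : IsMatrixAlgebra B₂) (hω : ∀ a ∈ B₁, ∀ b ∈ B₂, ω (a * b) = φ a * φ b)
    (hω' : ∀ a ∈ B₁, ∀ b ∈ B₂, ω' (a * b) = φ a * φ b) :
    Set.EqOn ω ω' (B₁ ⊔ B₂ : StarSubalgebra ℂ 𝒜) := by
  rw [← hκ.sup_range]
  exact eqOn_sup_of_eq_on_mul h₁ (h₂.range κ) hκ.commute_of_mem_range fun a ha b hb =>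
    (hκ.map_mul_of_mem_range hω a ha b hb).trans (hκ.map_mul_of_mem_range hω' a ha b hb).symm

theorem IsDecoupling.sq_norm_sub_le (hκ : IsDecoupling φ B₁ κ) (hφ : IsState φ) (hω : IsState ω)
    (h₁ : IsMatrixAlgebra B₁) (h₂ : IsMatrixAlgebra B₂)
    (hmul : ∀ a ∈ B₁, ∀ b ∈ B₂, ω (a * b) = φ a * φ b) {x : 𝒜} (hx : x ∈ B₁ ⊔ B₂) :
    ‖φ x - ω x‖ ^ 2 ≤ 2 * (vonNeumannEntropy B₁ φ + vonNeumannEntropy B₂ φ -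
      vonNeumannEntropy (B₁ ⊔ B₂) φ) * ‖x‖ ^ 2 := by
  rw [← hκ.sup_range] at hx ⊢
  rw [← h₂.vonNeumannEntropy_range hφ hκ.apply_eq]
  exact sq_norm_sub_le_of_map_mul hφ hω h₁ (h₂.range κ) hκ.commute_of_mem_range
    (hκ.map_mul_of_mem_range hmul) hx

end Decoupling

section Lattice

variable {Γ 𝒜 : Type*} [CStarAlgebra 𝒜] {φ ω ω' : StrongDual ℂ 𝒜}
variable {alg : Finset Γ → StarSubalgebra ℂ 𝒜} {A : Finset Γ} {s : ℝ}

open Classical in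
theorem entropy_le_of_mutualEntropy_le {I L : Finset Γ} {J : Set Γ}
    (h : mutualEntropy alg φ I J ≤ (s : EReal)) (hL : (L : Set Γ) ⊆ J) :
    vonNeumannEntropy (alg I) φ + vonNeumannEntropy (alg L) φ -
      vonNeumannEntropy (alg (I ∪ L)) φ ≤ s := by
  have hcond : conditionalEntropy alg φ I J ≤
      ((vonNeumannEntropy (alg (I ∪ L)) φ - vonNeumannEntropy (alg L) φ : ℝ) : EReal) :=
    iInf_le (fun L : {L : Finset Γ // (L : Set Γ) ⊆ J} =>
      ((vonNeumannEntropy (alg (I ∪ L.1)) φ - vonNeumannEntropy (alg L.1) φ : ℝ) : EReal)) ⟨L, hL⟩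
  have hmutual := (EReal.sub_le_sub le_rfl hcond).trans h
  rw [← EReal.coe_sub, EReal.coe_le_coe_iff] at hmutual
  linarith

theorem le_regionAlgebra (alg : Finset Γ → StarSubalgebra ℂ 𝒜) {J : Set Γ} {I : Finset Γ}
    (h : (I : Set Γ) ⊆ J) : alg I ≤ regionAlgebra alg J :=
  (le_iSup (fun I : {I : Finset Γ // (I : Set Γ) ⊆ J} => alg I.1) ⟨I, h⟩).trans
    (StarSubalgebra.le_topologicalClosure _)

open Classical in
/-- A local net of full matrix algebras: the common structure of spin and fermion systems. The
algebras of disjoint regions are not required to commute. -/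
structure IsMatrixNet (alg : Finset Γ → StarSubalgebra ℂ 𝒜) : Prop where
  isMatrixAlgebra : ∀ I, IsMatrixAlgebra (alg I)
  union : ∀ I J, Disjoint I J → alg (I ∪ J) = alg I ⊔ alg J
  dense : Dense (⋃ I, (alg I : Set 𝒜))

theorem IsMatrixNet.mono (hnet : IsMatrixNet alg) : Monotone alg := by
  classical
  intro I J hIJ
  rw [← Finset.union_sdiff_of_subset hIJ, hnet.union I _ Finset.disjoint_sdiff]
  exact le_sup_left

theorem IsMatrixNet.sup_eq (hnet : IsMatrixNet alg) {L : Finset Γ}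
    (hL : (L : Set Γ) ⊆ (A : Set Γ)ᶜ) [DecidableEq Γ] : alg A ⊔ alg L = alg (A ∪ L) := by
  rw [← hnet.union A L (Finset.disjoint_right.2 fun _ hi => hL hi)]
  congr!

theorem IsMatrixNet.coe_regionAlgebra (hnet : IsMatrixNet alg) (J : Set Γ) :
    (regionAlgebra alg J : Set 𝒜) =
      closure (⋃ I : {I : Finset Γ // (I : Set Γ) ⊆ J}, (alg I.1 : Set 𝒜)) := by
  classical
  have hdirected : Directed (· ≤ ·) fun I : {I : Finset Γ // (I : Set Γ) ⊆ J} => alg I.1 :=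
    fun I L => ⟨⟨I.1 ∪ L.1, by simpa only [Finset.coe_union] using Set.union_subset I.2 L.2⟩,
      hnet.mono Finset.subset_union_left, hnet.mono Finset.subset_union_right⟩
  have : Nonempty {I : Finset Γ // (I : Set Γ) ⊆ J} := ⟨⟨∅, by simp⟩⟩
  rw [regionAlgebra, StarSubalgebra.topologicalClosure_coe,
    StarSubalgebra.coe_iSup_of_directed hdirected]

theorem IsMatrixNet.dense_sup (hnet : IsMatrixNet alg) (A : Finset Γ) :
    Dense (⋃ L : {L : Finset Γ // (L : Set Γ) ⊆ (A : Set Γ)ᶜ},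
      ((alg A ⊔ alg L.1 : StarSubalgebra ℂ 𝒜) : Set 𝒜)) := by
  classical
  refine hnet.dense.mono (Set.iUnion_subset fun I => ?_)
  have hL : ((I \ A : Finset Γ) : Set Γ) ⊆ (A : Set Γ)ᶜ := fun i hi => (Finset.mem_sdiff.1 hi).2
  refine Set.Subset.trans ?_ (Set.subset_iUnion _ ⟨I \ A, hL⟩)
  rw [hnet.sup_eq hL, Finset.union_sdiff_self_eq_union]
  exact hnet.mono Finset.subset_union_right

theorem IsMatrixNet.map_mul_of_local (hnet : IsMatrixNet alg) {J : Set Γ}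
    (h : ∀ L : Finset Γ, (L : Set Γ) ⊆ J → ∀ a ∈ alg A, ∀ b ∈ alg L, ω (a * b) = φ a * φ b) :
    ∀ a ∈ alg A, ∀ b ∈ regionAlgebra alg J, ω (a * b) = φ a * φ b := by
  intro a ha b hb
  rw [← SetLike.mem_coe, hnet.coe_regionAlgebra] at hb
  refine closure_minimal (Set.iUnion_subset fun L b hb => h L.1 L.2 a ha b hb)
    (isClosed_eq (by fun_prop) (by fun_prop) : IsClosed {b | ω (a * b) = φ a * φ b}) hb

theorem IsProductState.map_mul_of_mem_alg (hω : IsProductState alg φ A ω) {L : Finset Γ}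
    (hL : (L : Set Γ) ⊆ (A : Set Γ)ᶜ) : ∀ a ∈ alg A, ∀ b ∈ alg L, ω (a * b) = φ a * φ b :=
  fun a ha b hb => hω.map_mul a ha b (le_regionAlgebra alg hL hb)

/-- Every finite region outside `A` can be decoupled from `A` in `φ`. -/
def HasDecouplings (alg : Finset Γ → StarSubalgebra ℂ 𝒜) (φ : StrongDual ℂ 𝒜) (A : Finset Γ) :
    Prop :=
  ∀ L : Finset Γ, (L : Set Γ) ⊆ (A : Set Γ)ᶜ → ∃ κ : alg L →⋆ₐ[ℂ] 𝒜, IsDecoupling φ (alg A) κ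

theorem exists_isProductState (hnet : IsMatrixNet alg) (hφ : IsState φ)
    (hdec : HasDecouplings alg φ A) : ∃ ω, IsProductState alg φ A ω := by
  obtain ⟨ω, hω, hmul⟩ := exists_isState_map_mul hφ (hnet.isMatrixAlgebra A)
  refine ⟨ω, hω, hnet.map_mul_of_local fun L hL => ?_⟩
  obtain ⟨κ, hκ⟩ := hdec L hL
  refine (hκ.map_mul_iff ω).1 fun a ha b => ?_
  rw [hmul a ha _ fun a ha => hκ.commute a ha b, hκ.apply_eq]

theorem IsProductState.unique (hnet : IsMatrixNet alg) (hdec : HasDecouplings alg φ A)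
    (hω : IsProductState alg φ A ω) (hω' : IsProductState alg φ A ω') : ω = ω' := by
  refine ContinuousLinearMap.coeFn_injective
    (Continuous.ext_on (hnet.dense_sup A) ω.continuous ω'.continuous fun x hx => ?_)
  obtain ⟨⟨L, hL⟩, hx⟩ := Set.mem_iUnion.1 hx
  obtain ⟨κ, hκ⟩ := hdec L hL
  exact hκ.eqOn_sup (hnet.isMatrixAlgebra A) (hnet.isMatrixAlgebra L) (hω.map_mul_of_mem_alg hL)
    (hω'.map_mul_of_mem_alg hL) hx

theorem IsProductState.sq_norm_apply_sub_le (hω : IsProductState alg φ A ω)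
    (hnet : IsMatrixNet alg) (hφ : IsState φ) (hdec : HasDecouplings alg φ A)
    (h : mutualEntropy alg φ A (A : Set Γ)ᶜ ≤ (s : EReal)) (x : 𝒜) :
    ‖(ω - φ) x‖ ^ 2 ≤ 2 * s * ‖x‖ ^ 2 := by
  classical
  refine (hnet.dense_sup A).induction (P := fun x => ‖(ω - φ) x‖ ^ 2 ≤ 2 * s * ‖x‖ ^ 2) ?_
    (isClosed_le (by fun_prop) (by fun_prop)) x
  intro x hx
  obtain ⟨⟨L, hL⟩, hx⟩ := Set.mem_iUnion.1 hx
  obtain ⟨κ, hκ⟩ := hdec L hL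
  have hlocal := hκ.sq_norm_sub_le hφ hω.isState (hnet.isMatrixAlgebra A) (hnet.isMatrixAlgebra L)
    (hω.map_mul_of_mem_alg hL) hx
  have hentropy := entropy_le_of_mutualEntropy_le h hL
  rw [← hnet.union A L (Finset.disjoint_right.2 fun _ hi => hL hi)] at hlocal
  rw [sub_apply, norm_sub_rev]
  exact hlocal.trans (by gcongr)

theorem IsProductState.sq_norm_sub_le (hω : IsProductState alg φ A ω) (hnet : IsMatrixNet alg)
    (hφ : IsState φ) (hdec : HasDecouplings alg φ A)
    (h : mutualEntropy alg φ A (A : Set Γ)ᶜ ≤ (s : EReal)) : ‖ω - φ‖ ^ 2 ≤ 2 * s := by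
  have hbound := hω.sq_norm_apply_sub_le hnet hφ hdec h
  have hs : 0 ≤ 2 * s := by
    have := hφ.nontrivial
    simpa only [norm_one, one_pow, mul_one] using (sq_nonneg _).trans (hbound 1)
  refine (Real.le_sqrt (norm_nonneg _) hs).1 ?_
  refine ContinuousLinearMap.opNorm_le_bound _ (Real.sqrt_nonneg _) fun x => ?_
  rw [← Real.sqrt_sq (norm_nonneg x), ← Real.sqrt_mul hs]
  exact Real.le_sqrt_of_sq_le (hbound x)

theorem IsProductState.norm_map_mul_sub_le (hω : IsProductState alg φ A ω) {a b : 𝒜}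
    (ha : a ∈ alg A) (hb : b ∈ regionAlgebra alg (A : Set Γ)ᶜ) :
    ‖φ (a * b) - φ a * φ b‖ ≤ ‖ω - φ‖ * (‖a‖ * ‖b‖) := by
  rw [← hω.map_mul a ha b hb, norm_sub_rev, ← sub_apply]
  exact (ContinuousLinearMap.le_opNorm _ _).trans (by gcongr; exact norm_mul_le a b)

end Lattice

namespace SpinSystem

variable {Γ 𝒜 : Type*} [CStarAlgebra 𝒜] (S : SpinSystem Γ 𝒜)

open Classical in
theorem alg_union {I J : Finset Γ} (h : Disjoint I J) : S.alg (I ∪ J) = S.alg I ⊔ S.alg J := by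
  let toSubmodule : StarSubalgebra ℂ 𝒜 → Submodule ℂ 𝒜 := fun B =>
    Subalgebra.toSubmodule B.toSubalgebra
  have hrange : toSubmodule (S.alg I) * toSubmodule (S.alg J) = toSubmodule (S.alg (I ∪ J)) :=
    (Submodule.mulMap_range _ _).symm.trans (S.mulMap_range I J h)
  refine le_antisymm ?_ (sup_le (fun x hx => ?_) fun x hx => ?_)
  · change toSubmodule (S.alg (I ∪ J)) ≤ toSubmodule (S.alg I ⊔ S.alg J)
    exact hrange ▸ Submodule.mul_le.2 fun a ha b hb => StarSubalgebra.mul_mem_sup ha hb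
  · change x ∈ toSubmodule (S.alg (I ∪ J))
    rw [← hrange, ← mul_one x]
    exact Submodule.mul_mem_mul hx (one_mem (S.alg J))
  · change x ∈ toSubmodule (S.alg (I ∪ J))
    rw [← hrange, ← one_mul x]
    exact Submodule.mul_mem_mul (one_mem (S.alg I)) hx

theorem isMatrixNet : IsMatrixNet S.alg where
  isMatrixAlgebra I := by
    obtain ⟨_, ⟨e⟩⟩ := S.matrix I
    exact isMatrixAlgebra_of_starAlgEquiv e
  union _ _ := S.alg_union
  dense := S.dense

theorem hasDecouplings (φ : StrongDual ℂ 𝒜) (A : Finset Γ) : HasDecouplings S.alg φ A :=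
  fun L hL => ⟨(S.alg L).subtype,
    { commute := fun a ha b =>
        S.commute A L (Finset.disjoint_right.2 fun _ hi => hL hi) a ha b b.2
      sup_range := congrArg (S.alg A ⊔ ·) (SetLike.coe_injective Subtype.range_coe)
      apply_eq := fun _ => rfl
      map_mul_iff := fun _ => forall₂_congr fun _ _ => Subtype.forall }⟩

end SpinSystem

section Glue

variable {𝒜 R : Type*} [CStarAlgebra 𝒜] [Ring R] [StarRing R] [Algebra ℂ R]
variable {p : 𝒜} {f g : R →⋆ₐ[ℂ] 𝒜}

/-- The ⋆-homomorphism which acts as `f` on a projection `p` and as `g` on its complement. -/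
def glue (hp : IsStarProjection p) (hf : ∀ x, Commute p (f x)) (hg : ∀ x, Commute p (g x)) :
    R →⋆ₐ[ℂ] 𝒜 where
  toFun x := p * f x + (1 - p) * g x
  map_one' := by simp only [map_one, mul_one, add_sub_cancel]
  map_zero' := by simp only [map_zero, mul_zero, add_zero]
  map_add' x y := by
    simp only [map_add, mul_add]
    abel
  map_mul' x y := by
    have hg' : ∀ x, Commute (1 - p) (g x) := fun x => (Commute.one_left _).sub_left (hg x)
    have hf' : ∀ x, Commute (1 - p) (f x) := fun x => (Commute.one_left _).sub_left (hf x)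
    rw [add_mul, mul_add, mul_add, (hf x).symm.mul_mul_mul_comm, (hf' x).symm.mul_mul_mul_comm,
      (hg x).symm.mul_mul_mul_comm, (hg' x).symm.mul_mul_mul_comm, hp.isIdempotentElem.eq,
      hp.one_sub.isIdempotentElem.eq, hp.mul_one_sub_self, hp.one_sub_mul_self, zero_mul, zero_mul,
      zero_add, add_zero, map_mul, map_mul]
  commutes' r := by
    simp only [AlgHomClass.commutes, ← add_mul, add_sub_cancel, one_mul]
  map_star' x := by
    have hg' : Commute (1 - p) (g (star x)) := (Commute.one_left _).sub_left (hg _)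
    rw [(hf _).eq, hg'.eq, star_add, star_mul, star_mul, hp.isSelfAdjoint.star_eq,
      hp.one_sub.isSelfAdjoint.star_eq, map_star, map_star]

theorem map_mul_proj_add {φ ω : StrongDual ℂ 𝒜} {B : StarSubalgebra ℂ 𝒜} (hp : p ∈ B) {x y : 𝒜}
    {t : ℂ} (hx : ∀ a ∈ B, ω (a * x) = φ a * t) (hy : ∀ a ∈ B, ω (a * y) = φ a * t) {a : 𝒜}
    (ha : a ∈ B) : ω (a * (p * x + (1 - p) * y)) = φ a * t := by
  rw [mul_add, ← mul_assoc, ← mul_assoc, map_add, hx _ (mul_mem ha hp),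
    hy _ (mul_mem ha (sub_mem (one_mem B) hp)), ← add_mul, ← map_add, ← mul_add, add_sub_cancel,
    mul_one]

theorem isStarProjection_half_one_add {v : 𝒜} (hv : IsSelfAdjoint v) (hsq : v * v = 1) :
    IsStarProjection ((1 / 2 : ℂ) • (1 + v)) where
  isIdempotentElem := by
    simp only [IsIdempotentElem, smul_mul_smul_comm, mul_add, add_mul, hsq, one_mul, mul_one]
    module
  isSelfAdjoint := by simp [IsSelfAdjoint, hv.star_eq]

end Glue

section Mode

variable {𝒜 : Type*} [CStarAlgebra 𝒜]

open Matrix in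
/-- The representation generated by one fermionic mode, in the basis whose first vector is the
occupied and whose second is the empty state. -/
noncomputable def modeRep (c : 𝒜) (hcc : c * c = 0) (hc : c * star c + star c * c = 1) :
    Matrix (Fin 2) (Fin 2) ℂ →⋆ₐ[ℂ] 𝒜 where
  toFun X := X 0 0 • (star c * c) + X 0 1 • star c + X 1 0 • c + X 1 1 • (c * star c)
  map_one' := by simp [add_comm (star c * c), hc]
  map_zero' := by simp
  map_add' X Y := by simp only [Matrix.add_apply]; module
  commutes' r := by
    simp only [algebraMap_eq_diagonal, Algebra.algebraMap_eq_smul_one (A := 𝒜), ← hc]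
    simp only [Fin.isValue, diagonal_apply_eq, Pi.algebraMap_apply, Algebra.algebraMap_self,
      RingHom.id_apply, ne_eq, zero_ne_one, not_false_eq_true, diagonal_apply_ne, zero_smul,
      add_zero, one_ne_zero, smul_add]
    module
  map_star' X := by
    simp only [Fin.isValue, star_apply, RCLike.star_def, star_add, star_smul, star_mul, star_star]
    abel
  map_mul' X Y := by
    have hss : star c * star c = 0 := by rw [← star_mul, hcc, star_zero]
    have hcsc : c * (star c * c) = c := by
      rw [← mul_assoc, eq_sub_of_add_eq hc, sub_mul, mul_assoc, hcc, mul_zero, one_mul, sub_zero]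
    have hscs : star c * (c * star c) = star c := by
      rw [← mul_assoc, eq_sub_of_add_eq' hc, sub_mul, mul_assoc, hss, mul_zero, one_mul, sub_zero]
    have hccx : ∀ x, c * (c * x) = 0 := fun x => by rw [← mul_assoc, hcc, zero_mul]
    have hssx : ∀ x, star c * (star c * x) = 0 := fun x => by rw [← mul_assoc, hss, zero_mul]
    simp only [Matrix.mul_apply, Fin.sum_univ_two, add_mul, mul_add, smul_mul_smul_comm, mul_assoc,
      hcsc, hscs, hccx, hssx, hss, hcc, mul_zero, smul_zero]
    module

theorem range_modeRep (c : 𝒜) (hcc : c * c = 0) (hc : c * star c + star c * c = 1) :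
    (modeRep c hcc hc).range = StarAlgebra.adjoin ℂ {c} := by
  have hmem : c ∈ StarAlgebra.adjoin ℂ {c} := StarAlgebra.self_mem_adjoin_singleton ℂ c
  apply le_antisymm
  · rintro _ ⟨X, rfl⟩
    have hs := star_mem hmem
    exact add_mem (add_mem (add_mem (SMulMemClass.smul_mem _ (mul_mem hs hmem))
      (SMulMemClass.smul_mem _ hs)) (SMulMemClass.smul_mem _ hmem))
      (SMulMemClass.smul_mem _ (mul_mem hmem hs))
  · refine StarAlgebra.adjoin_le (Set.singleton_subset_iff.2 ⟨Matrix.single 1 0 1, ?_⟩)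
    change _ • _ + _ • _ + _ • _ + _ • _ = c
    simp

theorem isMatrixAlgebra_bot : IsMatrixAlgebra (⊥ : StarSubalgebra ℂ 𝒜) := by
  let scalar : Matrix Unit Unit ℂ →⋆ₐ[ℂ] 𝒜 :=
    { toFun := fun X => algebraMap ℂ 𝒜 (X () ())
      map_one' := by simp
      map_zero' := by simp
      map_add' := by simp
      map_mul' := by simp [Matrix.mul_apply]
      commutes' := by simp [Matrix.algebraMap_eq_diagonal]
      map_star' := fun X => algebraMap_star_comm (X () ()) }
  have hrange : scalar.range = ⊥ := by
    refine le_bot_iff.1 ?_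
    rintro _ ⟨X, rfl⟩
    exact algebraMap_mem _ _
  exact hrange ▸ isMatrixAlgebra_range scalar

end Mode

namespace FermionSystem

variable {Γ 𝒜 : Type*} [CStarAlgebra 𝒜] (F : FermionSystem Γ 𝒜)

theorem c_mul_c (i j : Γ) : F.c i * F.c j = -(F.c j * F.c i) :=
  eq_neg_of_add_eq_zero_left (F.anticomm i j)

theorem star_c_mul_c {i j : Γ} (h : i ≠ j) : star (F.c i) * F.c j = -(F.c j * star (F.c i)) :=
  eq_neg_of_add_eq_zero_left ((F.star_anticomm i j).trans (if_neg h))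

theorem c_mul_c_self (i : Γ) : F.c i * F.c i = 0 := by
  have h := F.anticomm i i
  rw [← two_smul ℂ] at h
  exact (smul_eq_zero.1 h).resolve_left two_ne_zero

theorem c_mul_star_c_add (i : Γ) : F.c i * star (F.c i) + star (F.c i) * F.c i = 1 :=
  (add_comm _ _).trans ((F.star_anticomm i i).trans (if_pos rfl))

theorem c_mem_alg {I : Finset Γ} {i : Γ} (h : i ∈ I) : F.c i ∈ F.alg I :=
  StarAlgebra.subset_adjoin ℂ _ ⟨i, h, rfl⟩

theorem alg_le {I : Finset Γ} {B : StarSubalgebra ℂ 𝒜} (h : ∀ i ∈ I, F.c i ∈ B) : F.alg I ≤ B :=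
  StarAlgebra.adjoin_le (Set.image_subset_iff.2 h)

theorem alg_union [DecidableEq Γ] (I J : Finset Γ) : F.alg (I ∪ J) = F.alg I ⊔ F.alg J := by
  rw [alg, Finset.coe_union, Set.image_union]
  exact StarAlgebra.gc.l_sup

theorem commute_of_mem_alg {I : Finset Γ} {x : 𝒜} (h : ∀ i ∈ I, Commute x (F.c i))
    (hstar : ∀ i ∈ I, Commute (star x) (F.c i)) : ∀ b ∈ F.alg I, Commute x b := by
  have hle : F.alg I ≤ StarSubalgebra.centralizer ℂ {x} := F.alg_le fun i hi =>
    (StarSubalgebra.mem_centralizer_iff ℂ).2 (by rintro _ rfl; exact ⟨h i hi, hstar i hi⟩)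
  exact fun b hb => ((StarSubalgebra.mem_centralizer_iff ℂ).1 (hle hb) x rfl).1

theorem range_le {L : Finset Γ} {κ : F.alg L →⋆ₐ[ℂ] 𝒜} {B : StarSubalgebra ℂ 𝒜}
    (h : ∀ i (hi : i ∈ L), κ ⟨F.c i, F.c_mem_alg hi⟩ ∈ B) : κ.range ≤ B := by
  rintro _ ⟨⟨b, hb⟩, rfl⟩
  change κ ⟨b, hb⟩ ∈ B
  induction hb using StarAlgebra.adjoin_induction with
  | mem b hb =>
    obtain ⟨i, hi, rfl⟩ := hb
    exact h i hi
  | algebraMap r => exact (AlgHomClass.commutes κ r).symm ▸ algebraMap_mem B r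
  | add x y hx hy ihx ihy => exact (map_add κ ⟨x, hx⟩ ⟨y, hy⟩).symm ▸ add_mem ihx ihy
  | mul x y hx hy ihx ihy => exact (map_mul κ ⟨x, hx⟩ ⟨y, hy⟩).symm ▸ mul_mem ihx ihy
  | star x hx ihx => exact (map_star κ ⟨x, hx⟩).symm ▸ star_mem ihx

theorem grading_grading (x : 𝒜) : F.grading (F.grading x) = x := by
  have h : (F.grading : 𝒜 →⋆ₐ[ℂ] 𝒜).comp (F.grading : 𝒜 →⋆ₐ[ℂ] 𝒜) = StarAlgHom.id ℂ 𝒜 :=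
    F.ext_hom fun i => by
      change F.grading (F.grading (F.c i)) = F.c i
      rw [F.grading_c, map_neg, F.grading_c, neg_neg]
  exact DFunLike.congr_fun h x

theorem grading_mem_alg {I : Finset Γ} {x : 𝒜} (hx : x ∈ F.alg I) : F.grading x ∈ F.alg I := by
  have hle : F.alg I ≤ (F.alg I).comap (F.grading : 𝒜 →⋆ₐ[ℂ] 𝒜) := F.alg_le fun i hi => by
    change F.grading (F.c i) ∈ F.alg I
    rw [F.grading_c]
    exact neg_mem (F.c_mem_alg hi)
  exact hle hx

/-- `v` is a parity operator of the region `I`: an even self-adjoint unitary of `alg I` implementing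
the grading there and commuting with the modes outside `I`. -/
structure IsParity (I : Finset Γ) (v : 𝒜) : Prop where
  mem : v ∈ F.alg I
  isSelfAdjoint : IsSelfAdjoint v
  mul_self : v * v = 1
  anticomm : ∀ i ∈ I, v * F.c i = -(F.c i * v)
  comm : ∀ i ∉ I, Commute v (F.c i)
  grading_eq : F.grading v = v

theorem isParity_empty : F.IsParity ∅ 1 where
  mem := one_mem _
  isSelfAdjoint := .one 𝒜
  mul_self := one_mul 1
  anticomm := by simp
  comm _ _ := Commute.one_left _
  grading_eq := map_one _

variable {F} {I J A L : Finset Γ} {v w : 𝒜}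

theorem IsParity.commute_of_mem_alg (hv : F.IsParity A v) (hL : Disjoint A L) :
    ∀ b ∈ F.alg L, Commute v b :=
  F.commute_of_mem_alg (fun i hi => hv.comm i (Finset.disjoint_right.1 hL hi))
    (hv.isSelfAdjoint.star_eq.symm ▸ fun i hi => hv.comm i (Finset.disjoint_right.1 hL hi))

theorem IsParity.mul [DecidableEq Γ] (hv : F.IsParity I v) (hw : F.IsParity J w)
    (h : Disjoint I J) : F.IsParity (I ∪ J) (v * w) := by
  have hvw : Commute v w := hv.commute_of_mem_alg h w hw.mem
  refine ⟨?_, ?_, ?_, fun i hi => ?_, fun i hi => ?_, ?_⟩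
  · exact F.alg_union I J ▸ StarSubalgebra.mul_mem_sup hv.mem hw.mem
  · exact (hv.isSelfAdjoint.commute_iff hw.isSelfAdjoint).1 hvw
  · rw [hvw.symm.mul_mul_mul_comm, hv.mul_self, hw.mul_self, one_mul]
  · rcases Finset.mem_union.1 hi with hi | hi
    · have hwi : Commute w (F.c i) := hw.comm i (Finset.disjoint_left.1 h hi)
      rw [mul_assoc, hwi.eq, ← mul_assoc, hv.anticomm i hi, neg_mul, mul_assoc]
    · have hvi : Commute v (F.c i) := hv.comm i (Finset.disjoint_right.1 h hi)
      rw [mul_assoc, hw.anticomm i hi, mul_neg, ← mul_assoc, hvi.eq, mul_assoc]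
  · rw [Finset.notMem_union] at hi
    exact (hv.comm i hi.1).mul_left (hw.comm i hi.2)
  · rw [map_mul, hv.grading_eq, hw.grading_eq]

variable (F)

theorem isParity_singleton (i : Γ) :
    F.IsParity {i} (1 - (2 : ℂ) • (star (F.c i) * F.c i)) := by
  have hnc : star (F.c i) * F.c i * F.c i = 0 := by rw [mul_assoc, F.c_mul_c_self, mul_zero]
  have hcn : F.c i * (star (F.c i) * F.c i) = F.c i := by
    rw [← mul_assoc, eq_sub_of_add_eq (F.c_mul_star_c_add i), sub_mul, hnc, one_mul, sub_zero]
  have hnn : star (F.c i) * F.c i * (star (F.c i) * F.c i) = star (F.c i) * F.c i := by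
    rw [mul_assoc, hcn]
  have hci : F.c i ∈ F.alg {i} := F.c_mem_alg (Finset.mem_singleton_self i)
  refine ⟨?_, ?_, ?_, fun j hj => ?_, fun j hj => ?_, ?_⟩
  · exact sub_mem (one_mem _) (SMulMemClass.smul_mem _ (mul_mem (star_mem hci) hci))
  · simp [IsSelfAdjoint]
  · simp only [mul_sub, sub_mul, one_mul, mul_one, smul_mul_smul_comm, hnn]
    module
  · rw [Finset.mem_singleton.1 hj, sub_mul, mul_sub, smul_mul_assoc, mul_smul_comm, hnc, hcn,
      one_mul, mul_one]
    module
  · have hij : i ≠ j := fun h => hj (Finset.mem_singleton.2 h.symm)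
    have hnj : Commute (star (F.c i) * F.c i) (F.c j) := by
      rw [Commute, SemiconjBy, mul_assoc, F.c_mul_c i j, mul_neg, ← mul_assoc,
        F.star_c_mul_c hij, neg_mul, neg_neg, mul_assoc]
    exact (Commute.one_left _).sub_left (hnj.smul_left _)
  · rw [map_sub, map_one, map_smul, map_mul, map_star, F.grading_c, star_neg, neg_mul_neg]

theorem exists_isParity (I : Finset Γ) : ∃ v, F.IsParity I v := by
  classical
  induction I using Finset.induction_on with
  | empty => exact ⟨1, F.isParity_empty⟩
  | insert i I hi ih =>
    obtain ⟨v, hv⟩ := ih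
    exact ⟨_, (F.isParity_singleton i).mul hv (Finset.disjoint_singleton_left.2 hi)⟩

variable {F}

theorem IsParity.commute_mul_c (hv : F.IsParity A v) {i : Γ} (hi : i ∉ A) :
    ∀ a ∈ F.alg A, Commute (v * F.c i) a := by
  refine F.commute_of_mem_alg (fun j hj => ?_) (fun j hj => ?_)
  · rw [Commute, SemiconjBy, mul_assoc, F.c_mul_c i j, mul_neg, ← mul_assoc, hv.anticomm j hj,
      neg_mul, neg_neg, mul_assoc]
  · have hne : i ≠ j := fun h => hi (h ▸ hj)
    rw [Commute, SemiconjBy, star_mul, hv.isSelfAdjoint.star_eq, mul_assoc, hv.anticomm j hj,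
      mul_neg, ← mul_assoc, F.star_c_mul_c hne, neg_mul, neg_neg, mul_assoc]

theorem IsParity.isStarProjection (hv : F.IsParity A v) :
    IsStarProjection ((1 / 2 : ℂ) • (1 + v)) :=
  isStarProjection_half_one_add hv.isSelfAdjoint hv.mul_self

theorem IsParity.proj_mem (hv : F.IsParity A v) : (1 / 2 : ℂ) • (1 + v) ∈ F.alg A :=
  SMulMemClass.smul_mem _ (add_mem (one_mem _) hv.mem)

theorem IsParity.commute_proj (hv : F.IsParity A v) (hL : Disjoint A L) :
    ∀ b ∈ F.alg L, Commute ((1 / 2 : ℂ) • (1 + v)) b := fun b hb =>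
  ((Commute.one_left b).add_left (hv.commute_of_mem_alg hL b hb)).smul_left _

/-- The Klein transformation of a region `L` disjoint from `A`, multiplying the odd elements of
`alg L` by the parity operator `v` of `A` and fixing the even ones; they then commute with
`alg A`. -/
noncomputable def IsParity.klein (hv : F.IsParity A v) (hL : Disjoint A L) :
    F.alg L →⋆ₐ[ℂ] 𝒜 :=
  glue (f := (F.alg L).subtype) (g := (F.grading : 𝒜 →⋆ₐ[ℂ] 𝒜).comp (F.alg L).subtype)
    hv.isStarProjection (fun b => hv.commute_proj hL b b.2)
    fun b => hv.commute_proj hL _ (F.grading_mem_alg b.2)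

theorem IsParity.klein_apply (hv : F.IsParity A v) (hL : Disjoint A L) (b : F.alg L) :
    hv.klein hL b =
      (1 / 2 : ℂ) • (1 + v) * (b : 𝒜) + (1 - (1 / 2 : ℂ) • (1 + v)) * F.grading b :=
  rfl

theorem IsParity.klein_c (hv : F.IsParity A v) (hL : Disjoint A L) {i : Γ} (hi : i ∈ L) :
    hv.klein hL ⟨F.c i, F.c_mem_alg hi⟩ = v * F.c i := by
  rw [klein_apply, F.grading_c, mul_neg, ← sub_eq_add_neg, ← sub_mul]
  congr 1
  module

theorem IsParity.commute_klein (hv : F.IsParity A v) (hL : Disjoint A L) :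
    ∀ a ∈ F.alg A, ∀ b ∈ (hv.klein hL).range, Commute a b := by
  have hle : (hv.klein hL).range ≤ StarSubalgebra.centralizer ℂ (F.alg A : Set 𝒜) := by
    refine F.range_le fun i hi => (StarSubalgebra.mem_centralizer_iff ℂ).2 fun a ha => ?_
    have hcomm := hv.commute_mul_c (Finset.disjoint_right.1 hL hi)
    rw [hv.klein_c hL hi]
    exact ⟨(hcomm a ha).symm, (hcomm _ (star_mem ha)).symm⟩
  exact fun a ha b hb => ((StarSubalgebra.mem_centralizer_iff ℂ).1 (hle hb) a ha).1

theorem IsParity.sup_range_klein (hv : F.IsParity A v) (hL : Disjoint A L) :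
    F.alg A ⊔ (hv.klein hL).range = F.alg A ⊔ F.alg L := by
  refine le_antisymm (sup_le le_sup_left (F.range_le fun i hi => ?_))
    (sup_le le_sup_left (F.alg_le fun i hi => ?_))
  · rw [hv.klein_c hL hi]
    exact StarSubalgebra.mul_mem_sup hv.mem (F.c_mem_alg hi)
  · have hvc : F.c i = v * (v * F.c i) := by rw [← mul_assoc, hv.mul_self, one_mul]
    rw [hvc]
    exact StarSubalgebra.mul_mem_sup hv.mem ⟨_, hv.klein_c hL hi⟩

theorem IsParity.apply_klein (hv : F.IsParity A v) (hL : Disjoint A L) {φ : StrongDual ℂ 𝒜}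
    (hφ : F.IsEven φ) (b : F.alg L) : φ (hv.klein hL b) = φ b := by
  have hgrading : F.grading ((1 - (1 / 2 : ℂ) • (1 + v)) * b) =
      (1 - (1 / 2 : ℂ) • (1 + v)) * F.grading b := by
    rw [map_mul, map_sub, map_smul, map_add, map_one, hv.grading_eq]
  rw [klein_apply, map_add, ← hgrading, hφ, ← map_add, ← add_mul, add_sub_cancel, one_mul]

theorem IsParity.proj_mul_klein_add (hv : F.IsParity A v) (hL : Disjoint A L) (b : F.alg L) :
    (1 / 2 : ℂ) • (1 + v) * hv.klein hL b + (1 - (1 / 2 : ℂ) • (1 + v)) *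
      hv.klein hL ⟨F.grading b, F.grading_mem_alg b.2⟩ = b := by
  have hp := hv.isStarProjection
  simp only [klein_apply, F.grading_grading, mul_add, ← mul_assoc, hp.isIdempotentElem.eq,
    hp.one_sub.isIdempotentElem.eq, hp.mul_one_sub_self, hp.one_sub_mul_self, zero_mul, zero_add,
    add_zero]
  rw [← add_mul, add_sub_cancel, one_mul]

theorem IsParity.isDecoupling_klein (hv : F.IsParity A v) (hL : Disjoint A L)
    {φ : StrongDual ℂ 𝒜} (hφ : F.IsEven φ) : IsDecoupling φ (F.alg A) (hv.klein hL) where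
  commute a ha b := hv.commute_klein hL a ha _ ⟨b, rfl⟩
  sup_range := hv.sup_range_klein hL
  apply_eq := hv.apply_klein hL hφ
  map_mul_iff ω := by
    refine ⟨fun h a ha b hb => ?_, fun h a ha b => ?_⟩
    · have hgrading : ∀ a ∈ F.alg A,
          ω (a * hv.klein hL ⟨F.grading b, F.grading_mem_alg hb⟩) = φ a * φ b := fun a ha =>
        (h a ha _).trans (congrArg _ (hφ b))
      refine (congrArg (fun x => ω (a * x)) (hv.proj_mul_klein_add hL ⟨b, hb⟩)).symm.trans ?_
      exact map_mul_proj_add hv.proj_mem (fun a ha => h a ha _) hgrading ha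
    · have hgrading : ∀ a ∈ F.alg A, ω (a * F.grading b) = φ a * φ b := fun a ha =>
        (h a ha _ (F.grading_mem_alg b.2)).trans (congrArg _ (hφ b))
      exact map_mul_proj_add hv.proj_mem (fun a ha => h a ha _ b.2) hgrading ha

variable (F)

theorem isMatrixAlgebra_alg (I : Finset Γ) : IsMatrixAlgebra (F.alg I) := by
  classical
  induction I using Finset.induction_on with
  | empty =>
    have hbot : F.alg ∅ = ⊥ := le_bot_iff.1 (F.alg_le (by simp))
    exact hbot ▸ isMatrixAlgebra_bot
  | insert i I hi ih =>
    obtain ⟨v, hv⟩ := F.exists_isParity I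
    have hdisj : Disjoint I {i} := Finset.disjoint_singleton_right.2 hi
    have hmode : IsMatrixAlgebra (F.alg {i}) := by
      rw [alg, Finset.coe_singleton, Set.image_singleton,
        ← range_modeRep _ (F.c_mul_c_self i) (F.c_mul_star_c_add i)]
      exact isMatrixAlgebra_range _
    rw [Finset.insert_eq, Finset.union_comm, F.alg_union, ← hv.sup_range_klein hdisj]
    exact ih.sup (hmode.range _) (hv.commute_klein hdisj)

theorem isMatrixNet : IsMatrixNet F.alg where
  isMatrixAlgebra := F.isMatrixAlgebra_alg
  union I J _ := by classical exact F.alg_union I J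
  dense := F.dense

theorem hasDecouplings {φ : StrongDual ℂ 𝒜} (hφ : F.IsEven φ) (A : Finset Γ) :
    HasDecouplings F.alg φ A := fun L hL => by
  obtain ⟨v, hv⟩ := F.exists_isParity A
  exact ⟨_, hv.isDecoupling_klein (Finset.disjoint_right.2 fun _ hi => hL hi) hφ⟩

end FermionSystem

end QuantumLattice

open QuantumLattice in
theorem corollary2_general {Γ 𝒜 : Type*} [CStarAlgebra 𝒜]
    {alg : Finset Γ → StarSubalgebra ℂ 𝒜} (hnet : IsMatrixNet alg) {φ : StrongDual ℂ 𝒜}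
    (hφ : IsState φ) {A : Finset Γ} (hdec : HasDecouplings alg φ A) {s : ℝ}
    (h : mutualEntropy alg φ A (A : Set Γ)ᶜ ≤ ((2 * s : ℝ) : EReal)) :
    (∃! ω, IsProductState alg φ A ω) ∧
    (∀ ω, IsProductState alg φ A ω → ‖ω - φ‖ ^ 2 ≤ 4 * s) ∧
    (∀ a ∈ alg A, ∀ b ∈ regionAlgebra alg (A : Set Γ)ᶜ, ‖a‖ ≤ 1 → ‖b‖ ≤ 1 →
      ‖φ (a * b) - φ a * φ b‖ ≤ 2 * √s) := by
  have hsq : ∀ ω, IsProductState alg φ A ω → ‖ω - φ‖ ^ 2 ≤ 4 * s := fun ω hω => by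
    linarith [hω.sq_norm_sub_le hnet hφ hdec h]
  obtain ⟨ω, hω⟩ := exists_isProductState hnet hφ hdec
  refine ⟨⟨ω, hω, fun ω' hω' => hω'.unique hnet hdec hω⟩, hsq, fun a ha b hb ha1 hb1 => ?_⟩
  calc ‖φ (a * b) - φ a * φ b‖ ≤ ‖ω - φ‖ * (‖a‖ * ‖b‖) := hω.norm_map_mul_sub_le ha hb
    _ ≤ ‖ω - φ‖ := mul_le_of_le_one_right (norm_nonneg _) (mul_le_one₀ ha1 (norm_nonneg _) hb1)
    _ ≤ √(2 ^ 2 * s) := Real.le_sqrt_of_sq_le ((hsq ω hω).trans_eq (by norm_num))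
    _ = 2 * √s := by rw [Real.sqrt_mul (by positivity), Real.sqrt_sq zero_le_two]

theorem corollary2 {Γ 𝒜 : Type*} [CStarAlgebra 𝒜] (β : ℝ) (hβ : 0 < β) (A : Finset Γ) :
    -- quantum spin lattice systems
    (∀ (S : QuantumLattice.SpinSystem Γ 𝒜) (Φ : QuantumLattice.Potential S.alg)
      (φ : StrongDual ℂ 𝒜), QuantumLattice.IsState φ →
      QuantumLattice.mutualEntropy S.alg φ A (A : Set Γ)ᶜ ≤
        ((2 * β * ‖Φ.surfaceEnergy A‖ : ℝ) : EReal) →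
      (∃! ω, QuantumLattice.IsProductState S.alg φ A ω) ∧
      (∀ ω, QuantumLattice.IsProductState S.alg φ A ω →
        ‖ω - φ‖ ^ 2 ≤ 4 * β * ‖Φ.surfaceEnergy A‖) ∧
      (∀ a ∈ S.alg A, ∀ b ∈ QuantumLattice.regionAlgebra S.alg (A : Set Γ)ᶜ,
        ‖a‖ ≤ 1 → ‖b‖ ≤ 1 →
        ‖φ (a * b) - φ a * φ b‖ ≤ 2 * (β * ‖Φ.surfaceEnergy A‖) ^ (1 / 2 : ℝ))) ∧
    -- fermion lattice systems
    (∀ (F : QuantumLattice.FermionSystem Γ 𝒜) (Φ : QuantumLattice.Potential F.alg)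
      (φ : StrongDual ℂ 𝒜), (∀ K, F.grading (Φ.toFun K) = Φ.toFun K) →
      QuantumLattice.IsState φ → F.IsEven φ →
      QuantumLattice.mutualEntropy F.alg φ A (A : Set Γ)ᶜ ≤
        ((2 * β * ‖Φ.surfaceEnergy A‖ : ℝ) : EReal) →
      (∃! ω, QuantumLattice.IsProductState F.alg φ A ω) ∧
      (∀ ω, QuantumLattice.IsProductState F.alg φ A ω →
        ‖ω - φ‖ ^ 2 ≤ 4 * β * ‖Φ.surfaceEnergy A‖) ∧
      (∀ a ∈ F.alg A, ∀ b ∈ QuantumLattice.regionAlgebra F.alg (A : Set Γ)ᶜ,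
        ‖a‖ ≤ 1 → ‖b‖ ≤ 1 →
        ‖φ (a * b) - φ a * φ b‖ ≤ 2 * (β * ‖Φ.surfaceEnergy A‖) ^ (1 / 2 : ℝ))) := by
  simp only [mul_assoc, ← Real.sqrt_eq_rpow]
  exact ⟨fun S _ φ hφ h => corollary2_general S.isMatrixNet hφ (S.hasDecouplings φ A) h,
    fun F _ _ _ hφ hev h => corollary2_general F.isMatrixNet hφ (F.hasDecouplings hev A) h⟩
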